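/- **Proposition (Grassmannian model of $\Omega\mathrm{SU}(n)$).** Let $H^n=L^2(S^1;\mathbb{C}^n)$, and let $H^n_+\subset H^n$ be the closed linear span of the functions $\lambda\mapsto\lambda^i e_j$ with $i\ge 0$, $j=1,\dots,n$, where $e_1,\dots,e_n$ is the standard basis of $\mathbb{C}^n$. Let $\mathrm{Gr}^n$ be the set of closed subspaces $W\subset H^n$ such that: the orthogonal projection $W\to H^n_+$ is Fredholm and the orthogonal projection $W\to (H^n_+)^\perp$ is Hilbert–Schmidt; the images of the orthogonal projections $W^\perp\to H^n_+$ and $W\to (H^n_+)^\perp$ are contained in $C^\infty(S^1;\mathbb{C}^n)$; and $\lambda W\subseteq W$. Let $\Omega\mathrm{SU}(n)$ be the group of smooth loops $\gamma:S^1\to\mathrm{SU}(n)$ with $\gamma(1)=I$; a subspace $W$ corresponds to $\gamma$ if $W=\gamma H^n_+=\{\gamma f: f\in H^n_+\}$. For a subspace $W\subset H^n$ let $\wedge^n W$ be the linear span of the functions $\lambda\mapsto f_1(\lambda)\wedge\cdots\wedge f_n(\lambda)$, $f_1,\dots,f_n\in W$, with values in $\wedge^n\mathbb{C}^n$ (functions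 being identified when they agree almost everywhere). A subspace $W\in\mathrm{Gr}^n$ corresponds to a loop $\gamma\in\Omega\mathrm{SU}(n)$ if and only if it belongs to $$\mathrm{Gr}(\mathrm{SU}(n))=\{W\in\mathrm{Gr}^n : \wedge^n W=\wedge^n H^n_+\}.$$ -/

import Mathlib

open MeasureTheory Filter AddCircle
open scoped ContDiff

noncomputable section

namespace LoopGrassmannian

/-- The unit circle `S¹`, written additively: `t ∈ ℝ/ℤ` stands for `λ = exp(2πit)`, so that the
complex number `λ` is `fourier 1 t`, its powers are `λ ^ i = fourier i t`, and the point `λ = 1`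
is `t = 0`. -/
abbrev S1 : Type := UnitAddCircle

/-- The normalized Haar (rotation invariant) measure on the circle. -/
abbrev μ : Measure S1 := haarAddCircle

/-- `ℂⁿ` with its standard inner product. -/
abbrev V (n : ℕ) : Type := EuclideanSpace ℂ (Fin n)

/-- The Hilbert space `Hⁿ` of square-summable `ℂⁿ`-valued functions on the circle. -/
abbrev H (n : ℕ) : Type := Lp (V n) 2 μ

/-- The function `λ ↦ λ ^ i e_j`, as an element of `Hⁿ`. -/
def monomial {n : ℕ} (i : ℤ) (j : Fin n) : H n :=
  ContinuousMap.toLp (E := V n) 2 μ ℂ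
    { toFun := fun t => (fourier i t : ℂ) • EuclideanSpace.single j (1 : ℂ)
      continuous_toFun := (fourier i).continuous.smul continuous_const }

/-- `Hⁿ₊`, the closed span of the functions `λ ^ i e_j` with `i ≥ 0`. -/
def Hplus (n : ℕ) : Submodule ℂ (H n) :=
  (Submodule.span ℂ {f | ∃ (i : ℕ) (j : Fin n), f = monomial (i : ℤ) j}).topologicalClosure

instance (n : ℕ) : CompleteSpace (Hplus n) :=
  (Submodule.isClosed_topologicalClosure _).completeSpace_coe

/-- A function on the circle is smooth if it is smooth in the angular variable. -/
def SmoothOnCircle {E : Type*} [NormedAddCommGroup E] [NormedSpace ℝ E] (g : S1 → E) : Prop :=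
  ContDiff ℝ ∞ fun x : ℝ => g (x : S1)

/-- The `L²` class `f` lies in `C^∞(S¹; ℂⁿ)`. -/
def IsSmoothClass {n : ℕ} (f : H n) : Prop :=
  ∃ g : S1 → V n, SmoothOnCircle g ∧ f =ᵐ[μ] g

/-- Hilbert-Schmidt operators: `∑ ‖T b_i‖² < ∞` for an orthonormal (Hilbert) basis `b` of the
source. -/
def IsHilbertSchmidt {E F : Type} [NormedAddCommGroup E] [InnerProductSpace ℂ E]
    [NormedAddCommGroup F] [InnerProductSpace ℂ F] (T : E →L[ℂ] F) : Prop :=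
  ∃ (ι : Type) (b : HilbertBasis ι ℂ E), Summable fun i => ‖T (b i)‖ ^ 2

/-- The smooth restricted Grassmannian `Grass(Hⁿ)`. -/
structure IsGrass {n : ℕ} (W : Submodule ℂ (H n)) : Prop where
  isClosed : IsClosed (W : Set (H n))
  fredholm : ((Hplus n).orthogonalProjectionOnto ∘L W.subtypeL).IsFredholm
  hilbertSchmidt : IsHilbertSchmidt ((Hplus n)ᗮ.orthogonalProjectionOnto ∘L W.subtypeL)
  smooth_plus : ∀ f ∈ Wᗮ, IsSmoothClass ((Hplus n).starProjection f)
  smooth_minus : ∀ f ∈ W, IsSmoothClass ((Hplus n)ᗮ.starProjection f)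

/-- `λ W`, the image of `W` under multiplication by the coordinate `λ` of the circle. -/
def shift {n : ℕ} (W : Submodule ℂ (H n)) : Set (H n) :=
  {g | ∃ f ∈ W, ∀ᵐ t ∂μ, g t = (fourier 1 t : ℂ) • f t}

/-- `Grⁿ`, the set of `W ∈ Grass(Hⁿ)` with `λ W ⊆ W`. -/
def Gr (n : ℕ) : Set (Submodule ℂ (H n)) :=
  {W | IsGrass W ∧ shift W ⊆ W}

/-- The based loop group `Ω G` of a group `G` of `n × n` matrices: smooth maps `γ : S¹ → G`
with `γ(1) = 1`. -/
structure BasedLoop {n : ℕ} (G : Submonoid (Matrix (Fin n) (Fin n) ℂ)) where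
  toFun : S1 → Matrix (Fin n) (Fin n) ℂ
  mem : ∀ t, toFun t ∈ G
  smooth : ∀ i j, SmoothOnCircle fun t => toFun t i j
  based : toFun 0 = 1

/-- `γ W = {γ f | f ∈ W}`, where `(γ f)(λ) = γ(λ) f(λ)`. -/
def loopImage {n : ℕ} (γ : S1 → Matrix (Fin n) (Fin n) ℂ) (W : Submodule ℂ (H n)) :
    Set (H n) :=
  {g | ∃ f ∈ W, ∀ᵐ t ∂μ, g t = Matrix.toEuclideanLin (γ t) (f t)}

/-- `W` corresponds to the loop `γ`: `W = γ Hⁿ₊`. -/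
def CorrespondsTo {n : ℕ} {G : Submonoid (Matrix (Fin n) (Fin n) ℂ)}
    (W : Submodule ℂ (H n)) (γ : BasedLoop G) : Prop :=
  (W : Set (H n)) = loopImage γ.toFun (Hplus n)

/-- `f₁ ∧ ⋯ ∧ f_k`, the function `λ ↦ f₁(λ) ∧ ⋯ ∧ f_k(λ)` from the circle to `⋀ᵏ ℂⁿ`, up to
equality almost everywhere. -/
def wedge {n k : ℕ} (f : Fin k → H n) : Germ (ae μ) (⋀[ℂ]^k (V n)) :=
  ((fun t => exteriorPower.ιMulti ℂ k fun i => f i t : S1 → ⋀[ℂ]^k (V n)) :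
    Germ (ae μ) (⋀[ℂ]^k (V n)))

/-- `⋀ᵏ W`, the linear span of the pointwise products `f₁ ∧ ⋯ ∧ f_k` with all `f_i ∈ W`. -/
def wedgePower {n : ℕ} (k : ℕ) (W : Submodule ℂ (H n)) :
    Submodule ℂ (Germ (ae μ) (⋀[ℂ]^k (V n))) :=
  Submodule.span ℂ {F | ∃ f : Fin k → H n, (∀ i, f i ∈ W) ∧ F = wedge f}

/-- `Gr(SU(n)) = {W ∈ Grⁿ | ⋀ⁿ W = ⋀ⁿ Hⁿ₊}`. -/
def GrSU (n : ℕ) : Set (Submodule ℂ (H n)) :=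
  {W | W ∈ Gr n ∧ wedgePower n W = wedgePower n (Hplus n)}

end LoopGrassmannian

end

open MeasureTheory Filter AddCircle
open scoped ContDiff ComplexConjugate Topology

noncomputable section

namespace LoopGrassmannian

/-! If `W = γ Hⁿ₊` with `det γ = 1`, multiplication by `γ` scales every pointwise `n`-fold wedge by
`det γ = 1`, so the top wedge powers agree.

The converse is a Beurling–Lax argument on the wandering subspace `W ⊖ λW`. Its elements are smooth
(`isSmoothClass_of_mem_wandering`) and have constant pointwise inner products (`inner_smoothRep`),
so evaluation at a point is injective on it. The Fredholm condition excludes a nonzero `f` with all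
`λ^(-m) f` in `W`, so the wandering subspace generates `W` (`eq_closure_span_mulPow_wandering`).
Were its dimension below `n`, all `n`-fold wedges from `W` would vanish, against the wedge
hypothesis (`evalAt_surjective`). The wandering functions with values `e_j` at `λ = 1` are then the
columns of a smooth unitary loop `γ` with `γ(1) = I` and `W = γ Hⁿ₊`.

It remains to see that `det γ = 1`. The wedge hypothesis makes `det γ` and its conjugate finite sums
of `n`-fold products of Hardy functions. Such products need not be square integrable, so their
Fourier coefficients are not directly available. The Smirnov class is an algebra containing the
Hardy functions, and its bounded members have no negative frequencies (`IsSmirnov.isBddHardy`).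
Hence `det γ` is constant (`det_eq_of_wedgePower_eq`), equal to its value at `λ = 1`. -/

/-! ### Fourier coefficients of square-integrable functions -/

theorem norm_fourier_apply (k : ℤ) (t : S1) : ‖fourier k t‖ = 1 := by
  rw [fourier_apply, Circle.norm_coe]

/-- A square-integrable function on the circle is determined by its Fourier coefficients. -/
theorem ae_eq_zero_of_fourierCoeff_eq_zero {f : S1 → ℂ} (hf : MemLp f 2 μ)
    (h : ∀ k, fourierCoeff f k = 0) : f =ᵐ[μ] 0 := by
  have h0 : hf.toLp f = 0 := by
    apply (fourierBasis (T := 1)).repr.injective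
    ext k
    rw [fourierBasis_repr, fourierCoeff_congr_ae hf.coeFn_toLp, h]
    simp
  have := hf.coeFn_toLp
  rw [h0] at this
  exact this.symm.trans (Lp.coeFn_zero _ _ _)

/-- The Fourier coefficients of a product are the convolution of the Fourier coefficients. -/
theorem hasSum_fourierCoeff_mul {f g : S1 → ℂ} (hf : MemLp f 2 μ) (hg : MemLp g 2 μ) (k : ℤ) :
    HasSum (fun i => fourierCoeff g (k - i) * fourierCoeff f i)
      (fourierCoeff (fun t => f t * g t) k) := by
  -- The `k`-th coefficient of `f g` is the inner product of this function with `f`; Parseval then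
  -- gives the convolution.
  have hx : MemLp (fun t => conj (g t) * fourier k t) 2 μ := by
    have h1 : MemLp (fun t => fourier (-k) t * g t) 2 μ := by
      refine hg.of_le (((fourier (-k)).continuous.aestronglyMeasurable).mul hg.1) ?_
      exact ae_of_all _ fun t => by simp [norm_fourier_apply, -fourier_apply]
    refine h1.of_le ?_ ?_
    · exact (Complex.continuous_conj.comp_aestronglyMeasurable hg.1).mul
        (fourier k).continuous.aestronglyMeasurable
    · exact ae_of_all _ fun t => by simp [norm_fourier_apply, -fourier_apply]
  have key := (fourierBasis (T := 1)).hasSum_inner_mul_inner (hx.toLp _) (hf.toLp f)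
  have e1 : inner ℂ (hx.toLp _) (hf.toLp f) = fourierCoeff (fun t => f t * g t) k := by
    rw [L2.inner_def, fourierCoeff]
    apply integral_congr_ae
    filter_upwards [hx.coeFn_toLp, hf.coeFn_toLp] with t h1 h2
    rw [h1, h2, RCLike.inner_apply', fourier_neg]
    simp
    ring
  have e2 : ∀ i, inner ℂ (hx.toLp _) (fourierBasis i) = fourierCoeff g (k - i) := by
    intro i
    rw [L2.inner_def, fourierCoeff, coe_fourierBasis]
    apply integral_congr_ae
    filter_upwards [hx.coeFn_toLp, coeFn_fourierLp 2 i] with t h1 h2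
    rw [h1, h2, RCLike.inner_apply', neg_sub, sub_eq_add_neg, fourier_add, fourier_neg]
    simp only [map_mul, Complex.conj_conj, smul_eq_mul]
    ring
  have e3 : ∀ i, inner ℂ (fourierBasis i) (hf.toLp f) = fourierCoeff f i := by
    intro i
    rw [← HilbertBasis.repr_apply_apply, fourierBasis_repr, fourierCoeff_congr_ae hf.coeFn_toLp]
  rw [e1] at key
  simpa only [e2, e3] using key

/-! ### Hardy functions and the algebra of bounded ones -/

/-- Functions without negative Fourier coefficients, in `L²`. -/
structure IsHardy (f : S1 → ℂ) : Prop where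
  memLp : MemLp f 2 μ
  coeff : ∀ k < 0, fourierCoeff f k = 0

/-- Essentially bounded functions without negative Fourier coefficients. -/
structure IsBddHardy (f : S1 → ℂ) : Prop where
  meas : AEStronglyMeasurable f μ
  bdd : ∃ C, ∀ᵐ t ∂μ, ‖f t‖ ≤ C
  coeff : ∀ k < 0, fourierCoeff f k = 0

/-- In the convolution, `i` and `k - i` cannot both be nonnegative when `k < 0`. -/
theorem fourierCoeff_mul_eq_zero {f g : S1 → ℂ} (hf : IsHardy f) (hg : IsHardy g) {k : ℤ}
    (hk : k < 0) : fourierCoeff (fun t => f t * g t) k = 0 := by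
  refine (hasSum_fourierCoeff_mul hf.memLp hg.memLp k).unique ?_
  convert hasSum_zero with i
  rcases lt_or_ge i 0 with h | h
  · rw [hf.coeff i h, mul_zero]
  · rw [hg.coeff _ (by omega), zero_mul]

theorem fourierCoeff_mul_zero {f g : S1 → ℂ} (hf : IsHardy f) (hg : IsHardy g) :
    fourierCoeff (fun t => f t * g t) 0 = fourierCoeff f 0 * fourierCoeff g 0 := by
  refine (hasSum_fourierCoeff_mul hf.memLp hg.memLp 0).unique ?_
  convert hasSum_single (0 : ℤ) ?_ using 1
  · simp [mul_comm]
  · intro i hi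
    rcases lt_or_gt_of_ne hi with h | h
    · rw [hf.coeff i h, mul_zero]
    · rw [hg.coeff _ (by omega), zero_mul]

theorem IsBddHardy.isHardy {f : S1 → ℂ} (hf : IsBddHardy f) : IsHardy f :=
  ⟨MemLp.of_bound hf.meas hf.bdd.choose hf.bdd.choose_spec, hf.coeff⟩

theorem IsBddHardy.congr {f g : S1 → ℂ} (hf : IsBddHardy f) (h : f =ᵐ[μ] g) : IsBddHardy g := by
  obtain ⟨C, hC⟩ := hf.bdd
  refine ⟨hf.meas.congr h, ⟨C, ?_⟩, fourierCoeff_congr_ae h ▸ hf.coeff⟩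
  filter_upwards [hC, h] with t h1 h2
  rwa [← h2]

theorem IsBddHardy.add {f g : S1 → ℂ} (hf : IsBddHardy f) (hg : IsBddHardy g) :
    IsBddHardy (fun t => f t + g t) := by
  obtain ⟨C, hC⟩ := hf.bdd
  obtain ⟨D, hD⟩ := hg.bdd
  refine ⟨hf.meas.add hg.meas, ⟨C + D, ?_⟩, fun k hk => ?_⟩
  · filter_upwards [hC, hD] with t h1 h2
    exact (norm_add_le _ _).trans (add_le_add h1 h2)
  · have := congrFun (fourierCoeff.add (hf.isHardy.memLp.integrable (by norm_num))
      (hg.isHardy.memLp.integrable (by norm_num))) k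
    rw [Pi.add_apply, hf.coeff k hk, hg.coeff k hk, add_zero] at this
    exact this

theorem IsBddHardy.mul {f g : S1 → ℂ} (hf : IsBddHardy f) (hg : IsBddHardy g) :
    IsBddHardy (fun t => f t * g t) := by
  obtain ⟨C, hC⟩ := hf.bdd
  obtain ⟨D, hD⟩ := hg.bdd
  refine ⟨hf.meas.mul hg.meas, ⟨C * D, ?_⟩, fun k hk => ?_⟩
  · filter_upwards [hC, hD] with t h1 h2
    rw [norm_mul]
    exact mul_le_mul h1 h2 (norm_nonneg _) ((norm_nonneg _).trans h1)
  · exact fourierCoeff_mul_eq_zero hf.isHardy hg.isHardy hk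

theorem isBddHardy_const (c : ℂ) : IsBddHardy (fun _ => c) := by
  refine ⟨aestronglyMeasurable_const, ⟨‖c‖, ae_of_all _ fun _ => le_rfl⟩, fun k hk => ?_⟩
  have h := fourierCoeff.const_mul (T := 1) (fun t => fourier 0 t) c k
  rw [fourierCoeff_fourier] at h
  simpa [hk.ne] using h

theorem isBddHardy_fourier {k : ℤ} (hk : 0 ≤ k) : IsBddHardy (fun t => fourier k t) := by
  refine ⟨(fourier k).continuous.aestronglyMeasurable,
    ⟨1, ae_of_all _ fun t => (norm_fourier_apply k t).le⟩, fun i hi => ?_⟩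
  rw [fourierCoeff_fourier, Pi.single_eq_of_ne (by omega)]

/-- Bounded almost everywhere limits preserve the absence of negative Fourier coefficients. -/
theorem isBddHardy_of_tendsto {F : ℕ → S1 → ℂ} {f : S1 → ℂ} (C : ℝ)
    (hF : ∀ N, IsBddHardy (F N)) (hC : ∀ N, ∀ᵐ t ∂μ, ‖F N t‖ ≤ C)
    (hlim : ∀ᵐ t ∂μ, Tendsto (fun N => F N t) atTop (𝓝 (f t))) : IsBddHardy f := by
  have hm : AEStronglyMeasurable f μ :=
    aestronglyMeasurable_of_tendsto_ae atTop (fun N => (hF N).meas) hlim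
  refine ⟨hm, ⟨C, ?_⟩, fun k hk => ?_⟩
  · filter_upwards [ae_all_iff.2 hC, hlim] with t h1 h2
    exact le_of_tendsto h2.norm (Eventually.of_forall h1)
  · have h : Tendsto (fun N => fourierCoeff (F N) k) atTop (𝓝 (fourierCoeff f k)) := by
      refine tendsto_integral_of_dominated_convergence (fun _ => C)
        (fun N => (fourier (-k)).continuous.aestronglyMeasurable.smul (hF N).meas)
        (integrable_const _) (fun N => ?_) ?_
      · filter_upwards [hC N] with t ht
        simpa [norm_fourier_apply, -fourier_apply] using ht
      · filter_upwards [hlim] with t ht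
        exact ht.const_smul _
    refine tendsto_nhds_unique h ?_
    simp only [(hF _).coeff k hk]
    exact tendsto_const_nhds

theorem IsBddHardy.pow {f : S1 → ℂ} (hf : IsBddHardy f) (m : ℕ) :
    IsBddHardy (fun t => f t ^ m) := by
  induction m with
  | zero => simpa using isBddHardy_const 1
  | succ m ih => simpa only [pow_succ] using ih.mul hf

theorem isBddHardy_finsetSum {ι : Type*} (s : Finset ι) {f : ι → S1 → ℂ}
    (hf : ∀ i ∈ s, IsBddHardy (f i)) : IsBddHardy (fun t => ∑ i ∈ s, f i t) := by
  classical
  induction s using Finset.induction_on with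
  | empty => simpa using isBddHardy_const 0
  | insert a s ha ih =>
    simp only [Finset.sum_insert ha]
    exact (hf a (by simp)).add (ih fun i hi => hf i (by simp [hi]))

/-- The partial sums of the exponential series are uniformly bounded by `exp C`, so
`isBddHardy_of_tendsto` applies. -/
theorem IsBddHardy.exp {f : S1 → ℂ} (hf : IsBddHardy f) :
    IsBddHardy (fun t => Complex.exp (f t)) := by
  obtain ⟨C, hC⟩ := hf.bdd
  refine isBddHardy_of_tendsto (F := fun N t => ∑ m ∈ Finset.range N, f t ^ m / m.factorial)
    (Real.exp C) (fun N => isBddHardy_finsetSum _ fun m _ => ?_) (fun N => ?_)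
    (ae_of_all _ fun t => ?_)
  · simpa only [div_eq_mul_inv] using (hf.pow m).mul (isBddHardy_const _)
  · filter_upwards [hC] with t ht
    calc ‖∑ m ∈ Finset.range N, f t ^ m / m.factorial‖
        ≤ ∑ m ∈ Finset.range N, ‖f t‖ ^ m / m.factorial := by
          refine (norm_sum_le _ _).trans (le_of_eq ?_)
          simp
      _ ≤ Real.exp ‖f t‖ := Real.sum_le_exp_of_nonneg (norm_nonneg _) N
      _ ≤ Real.exp C := Real.exp_le_exp.2 ht
  · rw [Complex.exp_eq_exp_ℂ]
    exact (NormedSpace.expSeries_div_hasSum_exp (f t)).tendsto_sum_nat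

/-! ### Analytic functions with prescribed real part -/

theorem fourierCoeff_zero_eq_integral (f : S1 → ℂ) : fourierCoeff f 0 = ∫ t, f t ∂μ := by
  simp [fourierCoeff]

theorem integrable_of_continuous {E : Type*} [NormedAddCommGroup E] {f : S1 → E}
    (hf : Continuous f) : Integrable f μ :=
  hf.integrable_of_hasCompactSupport (HasCompactSupport.of_compactSpace f)

theorem norm_toLp_sq (f : C(S1, ℂ)) :
    ‖ContinuousMap.toLp (E := ℂ) 2 μ ℂ f‖ ^ 2 = ∫ t, ‖f t‖ ^ 2 ∂μ := by
  have h : inner ℂ (ContinuousMap.toLp (E := ℂ) 2 μ ℂ f) (ContinuousMap.toLp (E := ℂ) 2 μ ℂ f)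
      = ((∫ t, ‖f t‖ ^ 2 ∂μ : ℝ) : ℂ) := by
    rw [ContinuousMap.inner_toLp, ← integral_complex_ofReal]
    congr 1 with t
    rw [RCLike.mul_conj]
    simp
  rw [inner_self_eq_norm_sq_to_K] at h
  refine Complex.ofReal_injective (Eq.trans ?_ h)
  simp

/-- Every trigonometric polynomial has the same real part as one without negative frequencies. -/
theorem exists_isBddHardy_re_eq {q : C(S1, ℂ)}
    (hq : q ∈ Submodule.span ℂ (Set.range (fourier (T := 1)))) :
    ∃ P : C(S1, ℂ), IsBddHardy P ∧ (∀ t, (P t).re = (q t).re) ∧ (fourierCoeff P 0).im = 0 := by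
  -- Taking real parts is not complex linear, so the induction carries an arbitrary factor `a`; a
  -- term of negative frequency is replaced by its conjugate.
  have key : ∀ a : ℂ, ∃ P : C(S1, ℂ), IsBddHardy P ∧ ∀ t, (P t).re = (a * q t).re := by
    induction hq using Submodule.span_induction with
    | mem x hx =>
      obtain ⟨k, rfl⟩ := hx
      intro a
      rcases le_or_gt 0 k with hk | hk
      · exact ⟨a • fourier k, (isBddHardy_const a).mul (isBddHardy_fourier hk), fun t => rfl⟩
      · refine ⟨conj a • fourier (-k),
          (isBddHardy_const _).mul (isBddHardy_fourier (by omega)), fun t => ?_⟩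
        rw [ContinuousMap.smul_apply, fourier_neg, smul_eq_mul, ← map_mul, Complex.conj_re]
    | zero => exact fun a => ⟨0, isBddHardy_const 0, fun t => by simp⟩
    | add x y _ _ hx hy =>
      intro a
      obtain ⟨P, hP, hPx⟩ := hx a
      obtain ⟨Q, hQ, hQy⟩ := hy a
      exact ⟨P + Q, hP.add hQ, fun t => by simp [hPx, hQy, mul_add]⟩
    | smul c x _ hx =>
      intro a
      obtain ⟨P, hP, hPx⟩ := hx (a * c)
      exact ⟨P, hP, fun t => by rw [hPx, mul_assoc]; rfl⟩
  obtain ⟨P, hP, hPq⟩ := key 1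
  -- An imaginary constant makes the mean real without changing the real part.
  refine ⟨P + ContinuousMap.const _ (-(Complex.I * (fourierCoeff P 0).im)),
    hP.add (isBddHardy_const _), fun t => by simp [hPq], ?_⟩
  rw [fourierCoeff_zero_eq_integral, fourierCoeff_zero_eq_integral]
  simp only [ContinuousMap.add_apply, ContinuousMap.const_apply]
  rw [integral_add (hP.isHardy.memLp.integrable (by norm_num)) (integrable_const _)]
  simp

/-- The imaginary part of an analytic function with real mean is controlled by its real part. -/
theorem norm_toLp_sq_le_two_mul {D r : C(S1, ℂ)} (hD : IsBddHardy D)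
    (hr : ∀ t, (D t).re = (r t).re) (h0 : (fourierCoeff D 0).im = 0) :
    ‖ContinuousMap.toLp (E := ℂ) 2 μ ℂ D‖ ^ 2 ≤ 2 * ‖ContinuousMap.toLp (E := ℂ) 2 μ ℂ r‖ ^ 2 := by
  rw [norm_toLp_sq, norm_toLp_sq, ← integral_const_mul]
  -- The mean of `D²` is the square of the real mean of `D`, hence nonnegative; and `|D|² + Re D² =
  -- 2 (Re D)²` pointwise.
  have h1 : 0 ≤ ∫ t, (D t * D t).re ∂μ := by
    have h2 := fourierCoeff_mul_zero hD.isHardy hD.isHardy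
    rw [fourierCoeff_zero_eq_integral (fun t => D t * D t)] at h2
    have h3 := integral_re (integrable_of_continuous (f := fun t => D t * D t) (by fun_prop))
    simp only [RCLike.re_to_complex] at h3
    rw [h3, h2, Complex.mul_re, h0]
    nlinarith [mul_self_nonneg (fourierCoeff D 0).re]
  have h4 : ∫ t, ‖D t‖ ^ 2 ∂μ + ∫ t, (D t * D t).re ∂μ ≤ ∫ t, 2 * ‖r t‖ ^ 2 ∂μ := by
    have i1 : Integrable (fun t => ‖D t‖ ^ 2) μ :=
      integrable_of_continuous (by fun_prop)
    have i2 : Integrable (fun t => (D t * D t).re) μ :=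
      integrable_of_continuous (by fun_prop)
    rw [← integral_add i1 i2]
    refine integral_mono (i1.add i2)
      (integrable_of_continuous (by fun_prop)) fun t => ?_
    have h5 := hr t
    simp only [Complex.sq_norm, Complex.normSq_apply, Complex.mul_re, h5]
    nlinarith [mul_self_nonneg (r t).im]
  linarith

/-- Approximation of the absolute value of an `L²` function by trigonometric polynomials whose
real part is bounded below. -/
theorem exists_trigPoly_near_norm (f : Lp ℂ 2 μ) (u : Lp ℂ 2 μ)
    (hu : u =ᵐ[μ] fun t => (‖f t‖ : ℂ)) {ε : ℝ} (hε : 0 < ε) :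
    ∃ q ∈ Submodule.span ℂ (Set.range (fourier (T := 1))),
      (∀ t, -ε ≤ (q t).re) ∧ ‖ContinuousMap.toLp (E := ℂ) 2 μ ℂ q - u‖ < ε := by
  obtain ⟨c, hc⟩ := (ContinuousMap.toLp_denseRange ℂ μ ℂ (p := 2)
    (by norm_num)).exists_dist_lt f (half_pos hε)
  -- Since `|c| ≥ 0` is approximated uniformly, and not only in `L²`, the real part of `q` stays
  -- above `-ε`.
  let b : C(S1, ℂ) := ⟨fun t => (‖c t‖ : ℂ), by fun_prop⟩
  have hb : ‖ContinuousMap.toLp (E := ℂ) 2 μ ℂ b - u‖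
      ≤ ‖ContinuousMap.toLp (E := ℂ) 2 μ ℂ c - f‖ := by
    refine Lp.norm_le_norm_of_ae_le ?_
    filter_upwards [Lp.coeFn_sub (ContinuousMap.toLp (E := ℂ) 2 μ ℂ b) u,
      Lp.coeFn_sub (ContinuousMap.toLp (E := ℂ) 2 μ ℂ c) f, hu,
      ContinuousMap.coeFn_toLp (E := ℂ) (p := 2) (𝕜 := ℂ) μ b,
      ContinuousMap.coeFn_toLp (E := ℂ) (p := 2) (𝕜 := ℂ) μ c] with t h1 h2 h3 h4 h5
    rw [h1, h2, Pi.sub_apply, Pi.sub_apply, h3, h4, h5]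
    change ‖(‖c t‖ : ℂ) - (‖f t‖ : ℂ)‖ ≤ _
    rw [← Complex.ofReal_sub, Complex.norm_real]
    exact abs_norm_sub_norm_le _ _
  have hbmem : b ∈ closure (Submodule.span ℂ (Set.range (fourier (T := 1))) : Set C(S1, ℂ)) := by
    rw [← Submodule.topologicalClosure_coe, span_fourier_closure_eq_top]
    trivial
  obtain ⟨q, hq, hqb⟩ := Metric.mem_closure_iff.1 hbmem (ε / 2) (half_pos hε)
  refine ⟨q, hq, fun t => ?_, ?_⟩
  · have h1 : ‖(b - q) t‖ ≤ ε / 2 :=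
      ((b - q).norm_coe_le_norm t).trans (by rw [← dist_eq_norm]; exact hqb.le)
    have h2 := (Complex.abs_re_le_norm ((b - q) t)).trans h1
    have h3 : ((b - q) t).re = ‖c t‖ - (q t).re := by
      simp [b]
    rw [h3, abs_le] at h2
    linarith [norm_nonneg (c t), h2.2]
  · have h1 : ‖ContinuousMap.toLp (E := ℂ) 2 μ ℂ (b - q)‖ ≤ ‖b - q‖ := by
      refine (Lp.norm_le_of_ae_bound (norm_nonneg (b - q)) ?_).trans ?_
      · filter_upwards [ContinuousMap.coeFn_toLp (E := ℂ) (p := 2) (𝕜 := ℂ) μ (b - q)] with t h1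
        rw [h1]
        exact (b - q).norm_coe_le_norm t
      · simp [measureUnivNNReal]
    rw [map_sub, ← dist_eq_norm, ← dist_eq_norm] at h1
    rw [← dist_eq_norm, ← dist_eq_norm] at hb
    rw [← dist_eq_norm]
    have h2 := dist_triangle (ContinuousMap.toLp (E := ℂ) 2 μ ℂ q)
      (ContinuousMap.toLp (E := ℂ) 2 μ ℂ b) u
    rw [dist_comm (ContinuousMap.toLp (E := ℂ) 2 μ ℂ q)
      (ContinuousMap.toLp (E := ℂ) 2 μ ℂ b)] at h2
    rw [dist_comm] at hc
    linarith

theorem exists_subseq_tendsto_ae {E : Type*} [NormedAddCommGroup E] {F : ℕ → Lp E 2 μ}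
    {f : Lp E 2 μ} (h : Tendsto F atTop (𝓝 f)) :
    ∃ φ : ℕ → ℕ, StrictMono φ ∧ ∀ᵐ t ∂μ, Tendsto (fun N => F (φ N) t) atTop (𝓝 (f t)) :=
  (tendstoInMeasure_of_tendsto_Lp h).exists_seq_tendsto_ae

/-- The absolute value of an `L²` function `f` is the real part of an analytic function `U`,
such that `exp (-ε U)` is bounded and analytic. -/
theorem exists_analytic_re_eq_norm {f : S1 → ℂ} (hf : MemLp f 2 μ) :
    ∃ U : S1 → ℂ, (∀ᵐ t ∂μ, (U t).re = ‖f t‖) ∧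
      ∀ ε : ℝ, 0 < ε → IsBddHardy fun t => Complex.exp (-(ε * U t)) := by
  have hu : MemLp (fun t => (‖f t‖ : ℂ)) 2 μ :=
    hf.of_le (Complex.continuous_ofReal.comp_aestronglyMeasurable hf.1.norm)
      (ae_of_all _ fun t => by simp)
  have hu' : hu.toLp _ =ᵐ[μ] fun t => (‖hf.toLp f t‖ : ℂ) := by
    filter_upwards [hu.coeFn_toLp, hf.coeFn_toLp] with t h1 h2
    rw [h1, h2]
  have hpos : ∀ N : ℕ, (0 : ℝ) < 1 / (N + 1) := fun N => by positivity
  choose q hq hqre hqu using fun N : ℕ => exists_trigPoly_near_norm (hf.toLp f) _ hu' (hpos N)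
  choose P hP hPre hP0 using fun N => exists_isBddHardy_re_eq (hq N)
  set T := ContinuousMap.toLp (E := ℂ) 2 μ ℂ
  have hqlim : Tendsto (fun N => T (q N)) atTop (𝓝 (hu.toLp _)) := by
    rw [tendsto_iff_norm_sub_tendsto_zero]
    exact squeeze_zero (fun _ => norm_nonneg _) (fun N => (hqu N).le)
      tendsto_one_div_add_atTop_nhds_zero_nat
  -- The `L²` bound on conjugate functions turns convergence of `q N` into the Cauchy property of `P
  -- N`.
  have hdist : ∀ N M, ‖T (P N) - T (P M)‖ ^ 2 ≤ 2 * ‖T (q N) - T (q M)‖ ^ 2 := by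
    intro N M
    rw [← map_sub, ← map_sub]
    have hneg : IsBddHardy (fun t => P N t + (-1) * P M t) :=
      (hP N).add ((isBddHardy_const (-1)).mul (hP M))
    refine norm_toLp_sq_le_two_mul (hneg.congr (ae_of_all _ fun t => ?_)) (fun t => ?_) ?_
    · simp [sub_eq_add_neg]
    · simp [hPre]
    · have h1 := hP0 N
      have h2 := hP0 M
      rw [fourierCoeff_zero_eq_integral] at *
      simp only [ContinuousMap.sub_apply]
      rw [integral_sub ((hP N).isHardy.memLp.integrable (by norm_num))
        ((hP M).isHardy.memLp.integrable (by norm_num)), Complex.sub_im, h1, h2, sub_zero]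
  have hcauchy : CauchySeq fun N => T (P N) := by
    rw [Metric.cauchySeq_iff]
    intro ε hε
    obtain ⟨N, hN⟩ := Metric.cauchySeq_iff.1 hqlim.cauchySeq (ε / 2) (half_pos hε)
    refine ⟨N, fun m hm k hk => ?_⟩
    have h1 := hN m hm k hk
    have h2 := hdist m k
    rw [dist_eq_norm] at h1 ⊢
    refine lt_of_pow_lt_pow_left₀ 2 hε.le ?_
    have h3 := norm_nonneg (T (q m) - T (q k))
    nlinarith
  obtain ⟨U, hU⟩ := cauchySeq_tendsto_of_complete hcauchy
  obtain ⟨φ, hφ, hφU⟩ := exists_subseq_tendsto_ae hU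
  obtain ⟨ψ, hψ, hψu⟩ := exists_subseq_tendsto_ae (hqlim.comp hφ.tendsto_atTop)
  have hPae : ∀ᵐ t ∂μ, ∀ N, T (P N) t = P N t :=
    ae_all_iff.2 fun N => ContinuousMap.coeFn_toLp (E := ℂ) (p := 2) (𝕜 := ℂ) μ (P N)
  have hqae : ∀ᵐ t ∂μ, ∀ N, T (q N) t = q N t :=
    ae_all_iff.2 fun N => ContinuousMap.coeFn_toLp (E := ℂ) (p := 2) (𝕜 := ℂ) μ (q N)
  have hlim : ∀ᵐ t ∂μ, Tendsto (fun N => P (φ (ψ N)) t) atTop (𝓝 (U t)) := by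
    filter_upwards [hφU, hPae] with t h1 h2
    simpa only [Function.comp_def, h2] using h1.comp hψ.tendsto_atTop
  refine ⟨U, ?_, fun ε hε => ?_⟩
  · filter_upwards [hlim, hψu, hqae, hu.coeFn_toLp] with t h1 h2 h3 h4
    simp only [Function.comp_def, h3, h4] at h2
    have h5 := (Complex.continuous_re.tendsto _).comp h1
    have h6 := (Complex.continuous_re.tendsto _).comp h2
    simp only [Function.comp_def, hPre] at h5 h6
    rw [tendsto_nhds_unique h5 h6, Complex.ofReal_re]
  -- The bound `exp ε` comes from `Re P N = Re q N ≥ -1/(N+1) ≥ -1`.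
  · refine isBddHardy_of_tendsto (F := fun N t => Complex.exp (-(ε * P (φ (ψ N)) t)))
      (Real.exp ε) (fun N => ?_) (fun N => ae_of_all _ fun t => ?_) ?_
    · simpa only [neg_mul] using ((isBddHardy_const (-ε)).mul (hP (φ (ψ N)))).exp
    · rw [Complex.norm_exp, Complex.neg_re, Complex.re_ofReal_mul, hPre]
      refine Real.exp_le_exp.2 ?_
      have h1 := hqre (φ (ψ N)) t
      have h2 : (1 : ℝ) / (((φ (ψ N) : ℕ) : ℝ) + 1) ≤ 1 := by
        rw [div_le_one (by positivity)]
        linarith [Nat.cast_nonneg (α := ℝ) (φ (ψ N))]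
      nlinarith
    · filter_upwards [hlim] with t ht
      exact (Complex.continuous_exp.tendsto _).comp (ht.const_mul _).neg

/-! ### The Smirnov class and its maximum principle -/

/-- The Smirnov class: quotients of bounded analytic functions by outer functions. -/
def IsSmirnov (F : S1 → ℂ) : Prop :=
  ∃ U : S1 → ℂ, (∀ᵐ t ∂μ, 0 ≤ (U t).re) ∧ ∀ ε : ℝ, 0 < ε →
    (IsBddHardy fun t => Complex.exp (-(ε * U t))) ∧
    IsBddHardy fun t => Complex.exp (-(ε * U t)) * F t

/-- With `Re U = |f|`, the product `exp (-ε U) f` has modulus `|f| exp (-ε |f|) ≤ 1/ε`. -/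
theorem IsHardy.isSmirnov {f : S1 → ℂ} (hf : IsHardy f) : IsSmirnov f := by
  obtain ⟨U, hU, hexp⟩ := exists_analytic_re_eq_norm hf.memLp
  refine ⟨U, ?_, fun ε hε => ⟨hexp ε hε, (hexp ε hε).meas.mul hf.memLp.1, ⟨1 / ε, ?_⟩,
    fun k hk => fourierCoeff_mul_eq_zero (hexp ε hε).isHardy hf hk⟩⟩
  · filter_upwards [hU] with t ht
    rw [ht]
    exact norm_nonneg _
  · filter_upwards [hU] with t ht
    rw [norm_mul, Complex.norm_exp, Complex.neg_re, Complex.re_ofReal_mul, ht, Real.exp_neg,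
      inv_mul_le_iff₀ (Real.exp_pos _), mul_one_div, le_div_iff₀ hε]
    linarith [Real.add_one_le_exp (ε * ‖f t‖)]

theorem isSmirnov_const (c : ℂ) : IsSmirnov fun _ => c :=
  (isBddHardy_const c).isHardy.isSmirnov

theorem IsSmirnov.congr {F G : S1 → ℂ} (hF : IsSmirnov F) (h : F =ᵐ[μ] G) : IsSmirnov G := by
  obtain ⟨U, hU, hF⟩ := hF
  refine ⟨U, hU, fun ε hε => ⟨(hF ε hε).1, (hF ε hε).2.congr ?_⟩⟩
  filter_upwards [h] with t ht
  rw [ht]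

/-- The exponential of `-ε (U + V)` serves as a common denominator; the same choice works for
products. -/
theorem IsSmirnov.add {F G : S1 → ℂ} (hF : IsSmirnov F) (hG : IsSmirnov G) :
    IsSmirnov fun t => F t + G t := by
  obtain ⟨U, hU, hF⟩ := hF
  obtain ⟨V, hV, hG⟩ := hG
  have hexp : ∀ (ε : ℝ) t, Complex.exp (-(ε * (U t + V t)))
      = Complex.exp (-(ε * U t)) * Complex.exp (-(ε * V t)) := fun ε t => by
    rw [← Complex.exp_add]; ring_nf
  refine ⟨fun t => U t + V t, ?_, fun ε hε => ⟨?_, ?_⟩⟩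
  · filter_upwards [hU, hV] with t h1 h2
    exact add_nonneg h1 h2
  · simpa only [hexp] using (hF ε hε).1.mul (hG ε hε).1
  · refine (((hF ε hε).2.mul (hG ε hε).1).add ((hF ε hε).1.mul (hG ε hε).2)).congr
      (ae_of_all _ fun t => ?_)
    simp only [hexp]
    ring

theorem IsSmirnov.mul {F G : S1 → ℂ} (hF : IsSmirnov F) (hG : IsSmirnov G) :
    IsSmirnov fun t => F t * G t := by
  obtain ⟨U, hU, hF⟩ := hF
  obtain ⟨V, hV, hG⟩ := hG
  have hexp : ∀ (ε : ℝ) t, Complex.exp (-(ε * (U t + V t)))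
      = Complex.exp (-(ε * U t)) * Complex.exp (-(ε * V t)) := fun ε t => by
    rw [← Complex.exp_add]; ring_nf
  refine ⟨fun t => U t + V t, ?_, fun ε hε => ⟨?_, ?_⟩⟩
  · filter_upwards [hU, hV] with t h1 h2
    exact add_nonneg h1 h2
  · simpa only [hexp] using (hF ε hε).1.mul (hG ε hε).1
  · refine ((hF ε hε).2.mul (hG ε hε).2).congr (ae_of_all _ fun t => ?_)
    simp only [hexp]
    ring

theorem isSmirnov_finsetSum {ι : Type*} (s : Finset ι) {f : ι → S1 → ℂ}
    (hf : ∀ i ∈ s, IsSmirnov (f i)) : IsSmirnov fun t => ∑ i ∈ s, f i t := by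
  classical
  induction s using Finset.induction_on with
  | empty => simpa using isSmirnov_const 0
  | insert a s ha ih =>
    simp only [Finset.sum_insert ha]
    exact (hf a (by simp)).add (ih fun i hi => hf i (by simp [hi]))

theorem isSmirnov_finsetProd {ι : Type*} (s : Finset ι) {f : ι → S1 → ℂ}
    (hf : ∀ i ∈ s, IsSmirnov (f i)) : IsSmirnov fun t => ∏ i ∈ s, f i t := by
  classical
  induction s using Finset.induction_on with
  | empty => simpa using isSmirnov_const 1
  | insert a s ha ih =>
    simp only [Finset.prod_insert ha]
    exact (hf a (by simp)).mul (ih fun i hi => hf i (by simp [hi]))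

/-- The Smirnov maximum principle. -/
theorem IsSmirnov.isBddHardy {F : S1 → ℂ} (hF : IsSmirnov F) {C : ℝ}
    (hC : ∀ᵐ t ∂μ, ‖F t‖ ≤ C) : IsBddHardy F := by
  obtain ⟨U, hU, hF⟩ := hF
  have hpos : ∀ N : ℕ, (0 : ℝ) < 1 / (N + 1) := fun N => by positivity
  -- As `ε = 1/(N+1)` tends to zero, `exp (-ε U) F` tends to `F` and stays bounded by `C`, because
  -- `Re U ≥ 0`.
  refine isBddHardy_of_tendsto C (fun N => (hF _ (hpos N)).2) (fun N => ?_)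
    (ae_of_all _ fun t => ?_)
  · filter_upwards [hC, hU] with t h1 h2
    rw [norm_mul, Complex.norm_exp, Complex.neg_re, Complex.re_ofReal_mul]
    have h3 : Real.exp (-((1 : ℝ) / (N + 1) * (U t).re)) ≤ 1 := by
      rw [Real.exp_le_one_iff]
      have := mul_nonneg (hpos N).le h2
      linarith
    nlinarith [norm_nonneg (F t)]
  · have h1 : Tendsto (fun N : ℕ => -((((1 : ℝ) / (N + 1) : ℝ) : ℂ) * U t)) atTop (𝓝 0) := by
      have h2 := (Complex.continuous_ofReal.tendsto _).comp
        (tendsto_one_div_add_atTop_nhds_zero_nat (𝕜 := ℝ))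
      simpa using (h2.mul_const (U t)).neg
    simpa using ((Complex.continuous_exp.tendsto _).comp h1).mul_const (F t)

theorem ae_eq_const_of_fourierCoeff_eq_zero {F : S1 → ℂ} (hF : MemLp F 2 μ)
    (h : ∀ k ≠ 0, fourierCoeff F k = 0) : F =ᵐ[μ] fun _ => fourierCoeff F 0 := by
  have e1 (c : ℂ) (k : ℤ) : fourierCoeff (T := 1) (fun t => F t + c) k
      = fourierCoeff F k + c * fourierCoeff (T := 1) (fun t => fourier 0 t) k := by
    have h3 := congrFun (fourierCoeff.add (T := 1) (hF.integrable (by norm_num))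
      (integrable_const c)) k
    rw [Pi.add_apply] at h3
    rw [← fourierCoeff.const_mul]
    simpa using! h3
  have hz : ∀ k, fourierCoeff (fun t => F t - fourierCoeff F 0) k = 0 := by
    intro k
    simp only [sub_eq_add_neg]
    rw [e1, fourierCoeff_fourier]
    rcases eq_or_ne k 0 with rfl | hk
    · simp
    · simp [h k hk, hk]
  filter_upwards [ae_eq_zero_of_fourierCoeff_eq_zero
    (hF.sub (memLp_const (fourierCoeff F 0))) hz] with t ht
  exact sub_eq_zero.1 ht

/-- If `F` and its complex conjugate both lie in the Smirnov class and `F` is bounded, then `F` is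
constant. -/
theorem ae_eq_const_of_isSmirnov_conj {F : S1 → ℂ} {C : ℝ} (hC : ∀ᵐ t ∂μ, ‖F t‖ ≤ C)
    (h1 : IsSmirnov F) (h2 : IsSmirnov fun t => conj (F t)) :
    F =ᵐ[μ] fun _ => fourierCoeff F 0 := by
  have hF := h1.isBddHardy hC
  have hG := h2.isBddHardy (C := C) (by simpa using hC)
  refine ae_eq_const_of_fourierCoeff_eq_zero hF.isHardy.memLp fun k hk => ?_
  rcases lt_or_gt_of_ne hk with hk | hk
  · exact hF.coeff k hk
  · have e2 : fourierCoeff F k = conj (fourierCoeff (fun t => conj (F t)) (-k)) := by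
      rw [fourierCoeff, fourierCoeff, ← integral_conj]
      congr 1 with t
      rw [neg_neg, fourier_neg]
      simp
    rw [e2, hG.coeff (-k) (by omega), map_zero]

/-! ### Multiplication operators on `Hⁿ` and the monomial basis -/

variable {n : ℕ}

theorem memLp_clm_apply {A : S1 → V n →L[ℂ] V n} (hA : Continuous A) (hn : ∀ t v, ‖A t v‖ = ‖v‖)
    (f : H n) : MemLp (fun t => A t (f t)) 2 μ := by
  refine (Lp.memLp f).of_le ?_ (ae_of_all _ fun t => (hn t _).le)
  exact (show Continuous fun p : (V n →L[ℂ] V n) × V n => p.1 p.2 by fun_prop)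
    |>.comp_aestronglyMeasurable (hA.aestronglyMeasurable.prodMk (Lp.aestronglyMeasurable f))

/-- Multiplication by a continuous family of isometries of `ℂⁿ`. -/
def mulIso (A : S1 → V n →L[ℂ] V n) (hA : Continuous A) (hn : ∀ t v, ‖A t v‖ = ‖v‖) :
    H n →ₗᵢ[ℂ] H n where
  toFun f := (memLp_clm_apply hA hn f).toLp _
  map_add' f g := by
    ext1
    filter_upwards [(memLp_clm_apply hA hn (f + g)).coeFn_toLp,
      (memLp_clm_apply hA hn f).coeFn_toLp, (memLp_clm_apply hA hn g).coeFn_toLp,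
      Lp.coeFn_add f g, Lp.coeFn_add ((memLp_clm_apply hA hn f).toLp _)
        ((memLp_clm_apply hA hn g).toLp _)] with t h1 h2 h3 h4 h5
    rw [h1, h5, Pi.add_apply, h2, h3, h4, Pi.add_apply, map_add]
  map_smul' c f := by
    ext1
    filter_upwards [(memLp_clm_apply hA hn (c • f)).coeFn_toLp,
      (memLp_clm_apply hA hn f).coeFn_toLp,
      Lp.coeFn_smul c f, Lp.coeFn_smul c ((memLp_clm_apply hA hn f).toLp _)] with t h1 h2 h4 h5
    rw [h1, RingHom.id_apply, h5, Pi.smul_apply, h2, h4, Pi.smul_apply, map_smul]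
  norm_map' f := by
    change ‖(memLp_clm_apply hA hn f).toLp _‖ = _
    rw [Lp.norm_toLp, Lp.norm_def, eLpNorm_congr_norm_ae (ae_of_all _ fun t => hn t (f t))]

theorem coeFn_mulIso (A : S1 → V n →L[ℂ] V n) (hA : Continuous A) (hn : ∀ t v, ‖A t v‖ = ‖v‖)
    (f : H n) : mulIso A hA hn f =ᵐ[μ] fun t => A t (f t) :=
  (memLp_clm_apply hA hn f).coeFn_toLp

/-- Multiplication by `λ ^ k`. -/
def mulPow (k : ℤ) : H n →ₗᵢ[ℂ] H n :=
  mulIso (fun t => (fourier k t : ℂ) • ContinuousLinearMap.id ℂ (V n))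
    ((fourier k).continuous.smul continuous_const)
    fun t v => by simp [norm_smul, norm_fourier_apply, -fourier_apply]

theorem coeFn_mulPow (k : ℤ) (f : H n) :
    mulPow k f =ᵐ[μ] fun t => (fourier k t : ℂ) • f t :=
  coeFn_mulIso _ _ _ f

theorem mulPow_mulPow (k l : ℤ) (f : H n) : mulPow k (mulPow l f) = mulPow (k + l) f := by
  ext1
  filter_upwards [coeFn_mulPow k (mulPow l f), coeFn_mulPow l f, coeFn_mulPow (k + l) f]
    with t h1 h2 h3
  rw [h1, h2, h3, fourier_add, smul_smul]

theorem mulPow_zero (f : H n) : mulPow 0 f = f := by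
  ext1
  filter_upwards [coeFn_mulPow 0 f] with t h1
  rw [h1, fourier_zero, one_smul]

theorem inner_mulPow_right (k : ℤ) (f g : H n) :
    inner ℂ f (mulPow k g) = inner ℂ (mulPow (-k) f) g := by
  rw [← (mulPow (n := n) (-k)).inner_map_map f, mulPow_mulPow, neg_add_cancel, mulPow_zero]

theorem coeFn_monomial (i : ℤ) (j : Fin n) :
    (monomial i j : H n) =ᵐ[μ] fun t => (fourier i t : ℂ) • EuclideanSpace.single j (1 : ℂ) :=
  ContinuousMap.coeFn_toLp (E := V n) (p := 2) (𝕜 := ℂ) μ _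

theorem mulPow_monomial (k i : ℤ) (j : Fin n) :
    mulPow k (monomial i j) = monomial (k + i) j := by
  ext1
  filter_upwards [coeFn_mulPow k (monomial i j), coeFn_monomial i j, coeFn_monomial (k + i) j]
    with t h1 h2 h3
  rw [h1, h2, h3, fourier_add, smul_smul]

theorem inner_monomial (i : ℤ) (j : Fin n) (f : H n) :
    inner ℂ (monomial i j) f = fourierCoeff (fun t => f t j) i := by
  rw [L2.inner_def, fourierCoeff]
  apply integral_congr_ae
  filter_upwards [coeFn_monomial i j] with t h1
  rw [h1, inner_smul_left, EuclideanSpace.inner_single_left, fourier_neg]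
  simp

theorem memLp_coord (f : H n) (j : Fin n) : MemLp (fun t => f t j) 2 μ := by
  refine (Lp.memLp f).of_le ?_ (ae_of_all _ fun t => PiLp.norm_apply_le (f t) j)
  exact (show Continuous fun v : V n => v j by fun_prop).comp_aestronglyMeasurable
    (Lp.aestronglyMeasurable f)

theorem eq_zero_of_inner_monomial {f : H n} (h : ∀ i j, inner ℂ (monomial i j) f = 0) :
    f = 0 := by
  have h1 : ∀ᵐ t ∂μ, ∀ j, f t j = 0 := by
    rw [ae_all_iff]
    intro j
    exact ae_eq_zero_of_fourierCoeff_eq_zero (memLp_coord f j) fun k => by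
      rw [← inner_monomial, h]
  ext1
  filter_upwards [h1, Lp.coeFn_zero (V n) 2 μ] with t h2 h3
  rw [h3]
  ext j
  exact h2 j

theorem orthonormal_monomial :
    Orthonormal ℂ fun p : ℤ × Fin n => (monomial p.1 p.2 : H n) := by
  rw [orthonormal_iff_ite]
  rintro ⟨i, j⟩ ⟨k, l⟩
  have h : (fun t => (monomial k l : H n) t j) =ᵐ[μ]
      fun t => (EuclideanSpace.single l (1 : ℂ) : V n) j * fourier k t := by
    filter_upwards [coeFn_monomial k l] with t ht
    rw [ht]
    simp [mul_comm]
  rw [inner_monomial, fourierCoeff_congr_ae h, fourierCoeff.const_mul, fourierCoeff_fourier]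
  by_cases h1 : i = k <;> by_cases h2 : j = l <;> simp [h1, h2]

/-- The monomials `λ ^ i e_j` as a Hilbert basis of `Hⁿ`. -/
def monomialBasis (n : ℕ) : HilbertBasis (ℤ × Fin n) ℂ (H n) :=
  HilbertBasis.mkOfOrthogonalEqBot orthonormal_monomial <| by
    rw [Submodule.eq_bot_iff]
    intro f hf
    refine eq_zero_of_inner_monomial fun i j => ?_
    exact (Submodule.mem_orthogonal _ _).1 hf _ (Submodule.subset_span ⟨(i, j), rfl⟩)

theorem monomialBasis_apply (p : ℤ × Fin n) : monomialBasis n p = monomial p.1 p.2 := by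
  simp [monomialBasis]

theorem monomial_mem_Hplus {i : ℤ} (hi : 0 ≤ i) (j : Fin n) : monomial i j ∈ Hplus n :=
  Submodule.le_topologicalClosure _ (Submodule.subset_span ⟨i.toNat, j, by
    rw [Int.toNat_of_nonneg hi]⟩)

theorem Hplus_le {U : Submodule ℂ (H n)} (hU : IsClosed (U : Set (H n)))
    (h : ∀ (i : ℕ) j, monomial (i : ℤ) j ∈ U) : Hplus n ≤ U :=
  Submodule.topologicalClosure_minimal _ (Submodule.span_le.2 fun f hf => by
    obtain ⟨i, j, rfl⟩ := hf
    exact h i j) hU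

theorem mem_orthogonal_Hplus_iff {f : H n} :
    f ∈ (Hplus n)ᗮ ↔ ∀ i : ℤ, 0 ≤ i → ∀ j, inner ℂ (monomial i j) f = 0 := by
  refine ⟨fun hf i hi j => (Submodule.mem_orthogonal _ _).1 hf _ (monomial_mem_Hplus hi j),
    fun h => ?_⟩
  have h1 : Hplus n ≤ (Submodule.span ℂ {f})ᗮ :=
    Hplus_le (Submodule.isClosed_orthogonal _) fun k l => by
      rw [Submodule.mem_orthogonal_singleton_iff_inner_left]
      exact h k (by omega) l
  exact (Submodule.mem_orthogonal _ _).2 fun g hg =>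
    Submodule.mem_orthogonal_singleton_iff_inner_left.1 (h1 hg)

theorem mem_Hplus_iff {f : H n} :
    f ∈ Hplus n ↔ ∀ i : ℤ, i < 0 → ∀ j, inner ℂ (monomial i j) f = 0 := by
  constructor
  · intro hf i hi j
    have h : Hplus n ≤ (Submodule.span ℂ {(monomial i j : H n)})ᗮ := by
      refine Hplus_le (Submodule.isClosed_orthogonal _) fun k l => ?_
      rw [Submodule.mem_orthogonal_singleton_iff_inner_right]
      have := orthonormal_monomial.2 (i := (i, j)) (j := ((k : ℤ), l))
        (fun h => by have := congrArg Prod.fst h; simp at this; omega)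
      exact this
    exact Submodule.mem_orthogonal_singleton_iff_inner_right.1 (h hf)
  · intro h
    -- In the Parseval expansion against `g ∈ (Hplus n)ᗮ`, every frequency kills one of the two
    -- factors.
    rw [← Submodule.orthogonal_orthogonal (Hplus n), Submodule.mem_orthogonal]
    intro g hg
    rw [mem_orthogonal_Hplus_iff] at hg
    rw [← (monomialBasis n).tsum_inner_mul_inner]
    convert tsum_zero with p
    rw [monomialBasis_apply]
    rcases lt_or_ge p.1 0 with h1 | h1
    · rw [h _ h1, mul_zero]
    · rw [← inner_conj_symm, hg _ h1, map_zero, zero_mul]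

theorem isHardy_coord {f : H n} (hf : f ∈ Hplus n) (j : Fin n) : IsHardy fun t => f t j :=
  ⟨memLp_coord f j, fun k hk => by rw [← inner_monomial, mem_Hplus_iff.1 hf k hk j]⟩

/-! ### Negative powers of `λ` and the Fredholm condition -/

/-- A uniformly bounded sequence of operators which tends to zero on a Hilbert basis tends to zero
pointwise. -/
theorem tendsto_zero_of_hilbertBasis {ι E F : Type*} [NormedAddCommGroup E]
    [InnerProductSpace ℂ E] [NormedAddCommGroup F] [NormedSpace ℂ F]
    (b : HilbertBasis ι ℂ E) (T : ℕ → E →L[ℂ] F) (C : ℝ) (hC : ∀ m x, ‖T m x‖ ≤ C * ‖x‖)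
    (h : ∀ i, Tendsto (fun m => T m (b i)) atTop (𝓝 0)) (x : E) :
    Tendsto (fun m => T m x) atTop (𝓝 0) := by
  let U : Submodule ℂ E :=
    { carrier := {x | Tendsto (fun m => T m x) atTop (𝓝 0)}
      add_mem' := fun {x y} hx hy => by simpa using hx.add hy
      zero_mem' := by simp
      smul_mem' := fun c x hx => by simpa using hx.const_smul c }
  have hU : IsClosed (U : Set E) := by
    rw [← closure_subset_iff_isClosed]
    intro y hy
    change Tendsto _ _ _
    rw [Metric.tendsto_atTop]
    intro ε hε
    have hC' : 0 < |C| + 1 := by positivity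
    obtain ⟨z, hz, hyz⟩ := Metric.mem_closure_iff.1 hy (ε / 2 / (|C| + 1)) (by positivity)
    obtain ⟨N, hN⟩ := Metric.tendsto_atTop.1 (show Tendsto _ _ _ from hz) (ε / 2) (half_pos hε)
    refine ⟨N, fun m hm => ?_⟩
    have h1 := hN m hm
    rw [dist_zero_right] at h1 ⊢
    have h2 : T m y = T m (y - z) + T m z := by rw [← map_add, sub_add_cancel]
    have h3 : ‖T m (y - z)‖ ≤ ε / 2 := by
      rw [dist_eq_norm, lt_div_iff₀ hC'] at hyz
      refine (hC m _).trans (le_trans ?_ hyz.le)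
      nlinarith [norm_nonneg (y - z), le_abs_self C]
    rw [h2]
    linarith [norm_add_le (T m (y - z)) (T m z)]
  have h1 : (⊤ : Submodule ℂ E) ≤ U := by
    rw [← b.dense_span]
    refine Submodule.topologicalClosure_minimal _ (Submodule.span_le.2 ?_) hU
    rintro _ ⟨i, rfl⟩
    exact h i
  exact h1 trivial

/-- On a monomial, the powers `λ^(-m)` run through distinct basis vectors, and the coefficients of
`y` are square summable. -/
theorem tendsto_inner_mulPow_neg (y f : H n) :
    Tendsto (fun m : ℕ => inner ℂ y (mulPow (-(m : ℤ)) f)) atTop (𝓝 0) := by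
  refine tendsto_zero_of_hilbertBasis (monomialBasis n)
    (fun m : ℕ => (innerSL ℂ y) ∘L (mulPow (-(m : ℤ))).toContinuousLinearMap) ‖y‖ (fun m x => ?_)
    (fun p => ?_) f
  · simpa using norm_inner_le_norm (𝕜 := ℂ) y (mulPow (-(m : ℤ)) x)
  · have h1 := (orthonormal_monomial (n := n)).inner_products_summable y
    have h2 : Tendsto (fun q : ℤ × Fin n => inner ℂ (monomial q.1 q.2) y) cofinite (𝓝 0) := by
      have := h1.tendsto_cofinite_zero.sqrt
      simp only [Real.sqrt_zero, Real.sqrt_sq (norm_nonneg _)] at this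
      exact tendsto_zero_iff_norm_tendsto_zero.2 this
    have h3 : Tendsto (fun m : ℕ => (-(m : ℤ) + p.1, p.2)) atTop cofinite := by
      rw [← Nat.cofinite_eq_atTop]
      refine Function.Injective.tendsto_cofinite fun a b hab => ?_
      have := congrArg Prod.fst hab
      simpa using this
    have h4 := (Complex.continuous_conj.tendsto _).comp (h2.comp h3)
    simp only [Function.comp_def, inner_conj_symm, map_zero] at h4
    simpa [monomialBasis_apply, mulPow_monomial] using h4

/-- A monomial is moved into `(Hplus n)ᗮ` as soon as `m` exceeds its exponent. -/
theorem tendsto_starProjection_mulPow_neg (f : H n) :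
    Tendsto (fun m : ℕ => (Hplus n).starProjection (mulPow (-(m : ℤ)) f)) atTop (𝓝 0) := by
  refine tendsto_zero_of_hilbertBasis (monomialBasis n)
    (fun m : ℕ => (Hplus n).starProjection ∘L (mulPow (-(m : ℤ))).toContinuousLinearMap) 1
    (fun m x => ?_) (fun p => ?_) f
  · have := (Hplus n).starProjection.le_of_opNorm_le (Hplus n).starProjection_norm_le
      (mulPow (-(m : ℤ)) x)
    simpa using this
  · refine tendsto_const_nhds.congr' ?_
    filter_upwards [eventually_gt_atTop p.1.toNat] with m hm
    simp only [ContinuousLinearMap.comp_apply, LinearIsometry.coe_toContinuousLinearMap,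
      monomialBasis_apply, mulPow_monomial]
    symm
    rw [Submodule.starProjection_apply_eq_zero_iff, mem_orthogonal_Hplus_iff]
    intro i hi j
    exact orthonormal_monomial.2 (i := (i, j)) (j := (-(m : ℤ) + p.1, p.2))
      (fun h => by have := congrArg Prod.fst h; simp at this; omega)

/-- A finite rank operator maps bounded weakly null sequences to null sequences. -/
theorem tendsto_zero_of_finiteRange {E : Type*} [NormedAddCommGroup E] [InnerProductSpace ℂ E]
    [CompleteSpace E] (G : E →L[ℂ] E) (hG : G.toLinearMap.HasFiniteRange) {x : ℕ → E}
    (hx : ∀ y, Tendsto (fun m => inner ℂ y (x m)) atTop (𝓝 0)) :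
    Tendsto (fun m => G (x m)) atTop (𝓝 0) := by
  have : FiniteDimensional ℂ (G.toLinearMap.range) := Module.Finite.iff_fg.2 hG
  let e := stdOrthonormalBasis ℂ (G.toLinearMap.range)
  let z : ℕ → G.toLinearMap.range := fun m => ⟨G (x m), LinearMap.mem_range_self G.toLinearMap _⟩
  have hz : Tendsto (fun m => ‖z m‖ ^ 2) atTop (𝓝 0) := by
    simp only [← e.sum_sq_norm_inner_right]
    rw [← Finset.sum_const_zero (s := (Finset.univ : Finset (Fin (Module.finrank ℂ
      G.toLinearMap.range))))]
    refine tendsto_finsetSum _ fun i _ => ?_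
    have h1 := (hx (G.adjoint (e i))).norm.pow 2
    simp only [ContinuousLinearMap.adjoint_inner_left] at h1
    simpa using h1
  have h2 := hz.sqrt
  simp only [Real.sqrt_zero, Real.sqrt_sq (norm_nonneg _)] at h2
  exact tendsto_zero_iff_norm_tendsto_zero.2 h2

/-- A subspace in the Grassmannian contains no nonzero function `f` together with all the
functions `λ ^ (-m) f`. -/
theorem eq_zero_of_mulPow_neg_mem {W : Submodule ℂ (H n)} (hW : IsGrass W) {f : H n}
    (hf : ∀ m : ℕ, mulPow (-(m : ℤ)) f ∈ W) : f = 0 := by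
  have : CompleteSpace W := hW.isClosed.completeSpace_coe
  set u := (Hplus n).orthogonalProjectionOnto ∘L W.subtypeL with hu
  -- The vectors `x m = λ^(-m) f` are weakly null and `u (x m) → 0`. As `v ∘ u - 1` has finite rank,
  -- `x m → 0` in norm, whereas `‖x m‖ = ‖f‖`.
  obtain ⟨v, hv⟩ := hW.fredholm.exists_isQuasiInverse
  let x : ℕ → W := fun m => ⟨mulPow (-(m : ℤ)) f, hf m⟩
  have hG : (v ∘L u - ContinuousLinearMap.id ℂ W).toLinearMap.HasFiniteRange :=
    LinearMap.HasNoetherianRange.hasFiniteRange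
      ((LinearMap.FiniteRangeSetoid.equiv_iff_hasNoetherianRange).1 hv.1)
  have h1 := tendsto_zero_of_finiteRange _ hG (x := x) fun y => by
    simpa using tendsto_inner_mulPow_neg (y : H n) f
  have h2 : Tendsto (fun m => u (x m)) atTop (𝓝 0) := by
    have := (tendsto_starProjection_mulPow_neg f).norm
    rw [tendsto_zero_iff_norm_tendsto_zero]
    rw [norm_zero] at this
    exact this
  have h3 := ((v.continuous.tendsto 0).comp h2).sub h1
  have h4 : Tendsto x atTop (𝓝 0) := by
    simpa [Function.comp_def] using h3
  have h5 : Tendsto (fun m : ℕ => ‖x m‖) atTop (𝓝 ‖f‖) := by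
    refine tendsto_const_nhds.congr fun m => ?_
    simp [x]
  have := tendsto_nhds_unique h5 h4.norm
  simpa using this

/-! ### Unitary loops, determinants and top wedge powers -/

theorem SmoothOnCircle.continuous {E : Type*} [NormedAddCommGroup E] [NormedSpace ℝ E]
    {g : S1 → E} (hg : SmoothOnCircle g) : Continuous g :=
  (QuotientAddGroup.isQuotientMap_mk (AddSubgroup.zmultiples (1 : ℝ))).continuous_iff.2
    (ContDiff.continuous hg)

/-- Multiplication by a continuous family of unitary matrices. -/
def loopIso (γ : S1 → Matrix (Fin n) (Fin n) ℂ) (hc : Continuous γ)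
    (hu : ∀ t, γ t ∈ Matrix.unitaryGroup (Fin n) ℂ) : H n →ₗᵢ[ℂ] H n :=
  mulIso (fun t => Matrix.toEuclideanCLM (𝕜 := ℂ) (γ t))
    ((LinearMap.continuous_of_finiteDimensional
      (Matrix.toEuclideanCLM (n := Fin n) (𝕜 := ℂ)).toAlgEquiv.toLinearMap).comp hc)
    fun t v => by
      have h1 : (Matrix.toEuclideanCLM (𝕜 := ℂ) (γ t)) ∈ unitary (V n →L[ℂ] V n) :=
        Unitary.map_mem Matrix.toEuclideanCLM (hu t)
      exact ContinuousLinearMap.norm_map_of_mem_unitary h1 v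

theorem coeFn_loopIso (γ : S1 → Matrix (Fin n) (Fin n) ℂ) (hc : Continuous γ)
    (hu : ∀ t, γ t ∈ Matrix.unitaryGroup (Fin n) ℂ) (f : H n) :
    loopIso γ hc hu f =ᵐ[μ] fun t => Matrix.toEuclideanLin (γ t) (f t) :=
  coeFn_mulIso _ _ _ f

theorem mem_loopImage_iff (γ : S1 → Matrix (Fin n) (Fin n) ℂ) (hc : Continuous γ)
    (hu : ∀ t, γ t ∈ Matrix.unitaryGroup (Fin n) ℂ) (U : Submodule ℂ (H n)) (g : H n) :
    g ∈ loopImage γ U ↔ ∃ f ∈ U, loopIso γ hc hu f = g := by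
  constructor
  · rintro ⟨f, hf, h⟩
    exact ⟨f, hf, Lp.ext ((coeFn_loopIso γ hc hu f).trans (EventuallyEq.symm h))⟩
  · rintro ⟨f, hf, rfl⟩
    exact ⟨f, hf, coeFn_loopIso γ hc hu f⟩

/-- An alternating map in top degree is a multiple of the determinant. -/
theorem alternatingMap_eq_det_smul {ι R M N : Type*} [Fintype ι] [DecidableEq ι] [CommRing R]
    [AddCommGroup M] [Module R M] [AddCommGroup N] [Module R N] (e : Module.Basis ι R M)
    (f : M [⋀^ι]→ₗ[R] N) (v : ι → M) : f v = e.det v • f e := by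
  have h : f = (LinearMap.toSpanSingleton R N (f e)).compAlternatingMap e.det := by
    refine Module.Basis.ext_alternating e fun i h => ?_
    let σ : Equiv.Perm ι := Equiv.ofBijective i (Finite.injective_iff_bijective.1 h)
    change f (e ∘ σ) = LinearMap.toSpanSingleton R N (f e) (e.det (e ∘ σ))
    rw [AlternatingMap.map_perm, AlternatingMap.map_perm, e.det_self]
    simp [Units.smul_def, Int.cast_smul_eq_zsmul]
  conv_lhs => rw [h]
  rfl

/-- The standard basis of `ℂⁿ`. -/
abbrev stdBasis (n : ℕ) : Module.Basis (Fin n) ℂ (V n) :=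
  (EuclideanSpace.basisFun (Fin n) ℂ).toBasis

theorem det_toEuclideanLin (A : Matrix (Fin n) (Fin n) ℂ) :
    LinearMap.det (Matrix.toEuclideanLin A) = A.det := by
  rw [Matrix.toEuclideanLin_eq_toLin_orthonormal, LinearMap.det_toLin]

theorem ιMulti_toEuclideanLin (A : Matrix (Fin n) (Fin n) ℂ) (v : Fin n → V n) :
    exteriorPower.ιMulti ℂ n (fun i => Matrix.toEuclideanLin A (v i))
      = A.det • exteriorPower.ιMulti ℂ n v := by
  rw [alternatingMap_eq_det_smul (stdBasis n), alternatingMap_eq_det_smul (stdBasis n) _ v,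
    smul_smul, ← det_toEuclideanLin, ← (stdBasis n).det_comp]
  rfl

/-- The determinant as a linear functional on `⋀ⁿ ℂⁿ`. -/
def detFunctional (n : ℕ) : ⋀[ℂ]^n (V n) →ₗ[ℂ] ℂ :=
  exteriorPower.alternatingMapLinearEquiv (stdBasis n).det

theorem detFunctional_ιMulti (v : Fin n → V n) :
    detFunctional n (exteriorPower.ιMulti ℂ n v) = (stdBasis n).det v :=
  exteriorPower.alternatingMapLinearEquiv_apply_ιMulti _ _

theorem stdBasis_det_apply (v : Fin n → V n) :
    (stdBasis n).det v = Matrix.det (Matrix.of fun i j => v j i) := by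
  rw [Module.Basis.det_apply]
  congr 1

theorem det_monomial_zero :
    ∀ᵐ t ∂μ, (stdBasis n).det (fun j => (monomial 0 j : H n) t) = 1 := by
  filter_upwards [ae_all_iff.2 fun j => coeFn_monomial (n := n) 0 j] with t ht
  simp only [ht, fourier_zero, one_smul]
  convert (stdBasis n).det_self with j
  simp

/-- The Leibniz formula is a sum of `n`-fold products of Hardy functions, which leave `L²` but stay
in the Smirnov algebra. -/
theorem isSmirnov_det {f : Fin n → H n} (hf : ∀ i, f i ∈ Hplus n) :
    IsSmirnov fun t => (stdBasis n).det fun i => f i t := by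
  simp only [stdBasis_det_apply, Matrix.det_apply, Matrix.of_apply, Units.smul_def, zsmul_eq_mul]
  exact isSmirnov_finsetSum _ fun σ _ => (isSmirnov_const _).mul
    (isSmirnov_finsetProd _ fun i _ => (isHardy_coord (hf i) (σ i)).isSmirnov)

/-- The Smirnov class is a linear space, so generators suffice. The weight `c` is later `1`, the
conjugate of `det γ`, or `λ⁻¹`. -/
theorem isSmirnov_of_mem_wedgePower {U : Submodule ℂ (H n)} (c : S1 → ℂ)
    (hU : ∀ f : Fin n → H n, (∀ i, f i ∈ U) →
      IsSmirnov fun t => c t * (stdBasis n).det fun i => f i t)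
    {F : S1 → ⋀[ℂ]^n (V n)} (hF : (F : Germ (ae μ) (⋀[ℂ]^n (V n))) ∈ wedgePower n U) :
    IsSmirnov fun t => c t * detFunctional n (F t) := by
  have key : ∀ G ∈ wedgePower n U, ∀ F : S1 → ⋀[ℂ]^n (V n),
      (F : Germ (ae μ) (⋀[ℂ]^n (V n))) = G → IsSmirnov fun t => c t * detFunctional n (F t) := by
    intro G hG
    induction hG using Submodule.span_induction with
    | mem x hx =>
      obtain ⟨f, hf, rfl⟩ := hx
      intro F hF
      refine (hU f hf).congr ?_
      filter_upwards [Germ.coe_eq.1 hF] with t ht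
      rw [ht, detFunctional_ιMulti]
    | zero =>
      intro F hF
      refine (isSmirnov_const 0).congr ?_
      filter_upwards [Germ.coe_eq.1 (show (F : Germ (ae μ) (⋀[ℂ]^n (V n)))
        = ((0 : S1 → ⋀[ℂ]^n (V n)) : Germ (ae μ) (⋀[ℂ]^n (V n))) from hF)] with t ht
      rw [ht]
      simp
    | add x y _ _ hx hy =>
      intro F hF
      induction x using Germ.inductionOn with | _ x =>
      induction y using Germ.inductionOn with | _ y =>
      refine ((hx x rfl).add (hy y rfl)).congr ?_
      filter_upwards [Germ.coe_eq.1 (hF.trans (Germ.coe_add x y).symm)] with t ht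
      rw [ht, Pi.add_apply, map_add, mul_add]
    | smul a x _ hx =>
      intro F hF
      induction x using Germ.inductionOn with | _ x =>
      refine ((isSmirnov_const a).mul (hx x rfl)).congr ?_
      filter_upwards [Germ.coe_eq.1 (hF.trans (Germ.coe_smul a x).symm)] with t ht
      rw [ht, Pi.smul_apply, map_smul, smul_eq_mul]
      ring
  exact key _ hF F rfl

/-- Subspaces which correspond to a loop of determinant one have the same top wedge power. -/
theorem wedgePower_eq_of_eq_loopImage {γ : S1 → Matrix (Fin n) (Fin n) ℂ} (hc : Continuous γ)
    (hu : ∀ t, γ t ∈ Matrix.unitaryGroup (Fin n) ℂ) (hdet : ∀ t, (γ t).det = 1)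
    {U W : Submodule ℂ (H n)} (hW : (W : Set (H n)) = loopImage γ U) :
    wedgePower n W = wedgePower n U := by
  have hwedge : ∀ f : Fin n → H n, wedge (fun i => loopIso γ hc hu (f i)) = wedge f := by
    intro f
    refine Germ.coe_eq.2 ?_
    filter_upwards [ae_all_iff.2 fun i => coeFn_loopIso γ hc hu (f i)] with t ht
    simp only [ht, ιMulti_toEuclideanLin, hdet, one_smul]
  have hmem : ∀ g, g ∈ W ↔ ∃ f ∈ U, loopIso γ hc hu f = g := fun g => by
    rw [← SetLike.mem_coe, hW]
    exact mem_loopImage_iff γ hc hu U g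
  refine congrArg (Submodule.span ℂ) (Set.ext fun F => ⟨?_, ?_⟩)
  · rintro ⟨g, hg, rfl⟩
    choose f hf hfg using fun i => (hmem _).1 (hg i)
    exact ⟨f, hf, by rw [← hwedge f]; simp only [hfg]⟩
  · rintro ⟨f, hf, rfl⟩
    exact ⟨_, fun i => (hmem _).2 ⟨f i, hf i, rfl⟩, (hwedge f).symm⟩

/-- A continuous loop of unitary matrices which preserves the top wedge power of `Hⁿ₊` has constant
determinant. -/
theorem det_eq_of_wedgePower_eq {γ : S1 → Matrix (Fin n) (Fin n) ℂ} (hc : Continuous γ)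
    (hu : ∀ t, γ t ∈ Matrix.unitaryGroup (Fin n) ℂ) {W : Submodule ℂ (H n)}
    (hW : (W : Set (H n)) = loopImage γ (Hplus n))
    (hwedge : wedgePower n W = wedgePower n (Hplus n)) (t : S1) : (γ t).det = (γ 0).det := by
  have hmem : ∀ g, g ∈ W ↔ ∃ f ∈ Hplus n, loopIso γ hc hu f = g := fun g => by
    rw [← SetLike.mem_coe, hW]
    exact mem_loopImage_iff γ hc hu (Hplus n) g
  have hdetu : ∀ t, conj (γ t).det * (γ t).det = 1 := fun t =>
    (Unitary.mem_iff.1 (Matrix.det_of_mem_unitary (hu t))).1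
  have hdet : ∀ f : Fin n → H n, ∀ᵐ t ∂μ, (stdBasis n).det (fun i => loopIso γ hc hu (f i) t)
      = (γ t).det * (stdBasis n).det fun i => f i t := by
    intro f
    filter_upwards [ae_all_iff.2 fun i => coeFn_loopIso γ hc hu (f i)] with t ht
    simp only [ht, ← detFunctional_ιMulti, ιMulti_toEuclideanLin, map_smul, smul_eq_mul]
  let e : Fin n → H n := fun j => monomial 0 j
  have he : ∀ j, e j ∈ Hplus n := fun j => monomial_mem_Hplus le_rfl j
  have hedet : ∀ᵐ t ∂μ, (stdBasis n).det (fun i => e i t) = 1 := det_monomial_zero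
  -- The functions `γ e_j` lie in `W`, so their wedge, whose determinant is `det γ`, lies in the top
  -- power of `Hⁿ₊`.
  have h1 : IsSmirnov fun t => (γ t).det := by
    have h2 : wedge (fun i => loopIso γ hc hu (e i)) ∈ wedgePower n (Hplus n) := by
      rw [← hwedge]
      exact Submodule.subset_span ⟨_, fun i => (hmem _).2 ⟨e i, he i, rfl⟩, rfl⟩
    refine (isSmirnov_of_mem_wedgePower (fun _ => 1)
      (fun f hf => by simpa using isSmirnov_det hf) h2).congr ?_
    filter_upwards [hdet e, hedet] with t h3 h4
    rw [detFunctional_ιMulti, h3, h4]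
    ring
  -- Generators for `W` have determinant `det γ` times a Smirnov function; the conjugate weight
  -- cancels `det γ`. The constant wedge of the `e_j` lies in the same span.
  have h2 : IsSmirnov fun t => conj (γ t).det := by
    have h2 : wedge e ∈ wedgePower n W := by
      rw [hwedge]
      exact Submodule.subset_span ⟨_, he, rfl⟩
    refine (isSmirnov_of_mem_wedgePower (fun t => conj (γ t).det) (fun f hf => ?_) h2).congr ?_
    · choose g hg hgf using fun i => (hmem _).1 (hf i)
      refine (isSmirnov_det hg).congr ?_
      filter_upwards [hdet g] with t h3
      simp only [hgf] at h3
      rw [h3, ← mul_assoc, hdetu, one_mul]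
    · filter_upwards [hedet] with t h4
      rw [detFunctional_ιMulti, h4, mul_one]
  have h3 := ae_eq_const_of_isSmirnov_conj (C := 1) (ae_of_all _ fun t => by
    have h5 := congrArg norm (hdetu t)
    rw [norm_mul, RCLike.norm_conj, norm_one] at h5
    nlinarith [norm_nonneg (γ t).det]) h1 h2
  have h4 := (Continuous.ae_eq_iff_eq μ (hc.matrix_det) continuous_const).1 h3
  exact (congrFun h4 t).trans (congrFun h4 0).symm

/-! ### The wandering subspace and the Wold decomposition -/

variable {W : Submodule ℂ (H n)}

theorem mulPow_mem (hs : shift W ⊆ W) (k : ℕ) {f : H n} (hf : f ∈ W) :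
    mulPow (k : ℤ) f ∈ W := by
  induction k with
  | zero => simpa [mulPow_zero] using hf
  | succ k ih =>
    have h := hs ⟨_, ih, coeFn_mulPow 1 _⟩
    rw [mulPow_mulPow] at h
    rwa [Nat.cast_succ, add_comm]

/-- The wandering subspace `W ⊖ λW`. -/
def wandering (W : Submodule ℂ (H n)) : Submodule ℂ (H n) :=
  (W.map (mulPow 1).toLinearMap)ᗮ ⊓ W

theorem inner_mulPow_one_of_mem_wandering {w : H n} (hw : w ∈ wandering W) {f : H n}
    (hf : f ∈ W) : inner ℂ (mulPow 1 f) w = 0 :=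
  (Submodule.mem_orthogonal _ _).1 hw.1 _ (Submodule.mem_map_of_mem hf)

/-- A positive power of `λ` carries a wandering vector into `λW`; a negative power is moved to the
other argument. -/
theorem inner_wandering_mulPow (hs : shift W ⊆ W) {v w : H n} (hv : v ∈ wandering W)
    (hw : w ∈ wandering W) {k : ℤ} (hk : k ≠ 0) : inner ℂ v (mulPow k w) = 0 := by
  have key : ∀ {v w : H n}, v ∈ wandering W → w ∈ wandering W → ∀ m : ℕ,
      inner ℂ (mulPow ((m : ℤ) + 1) v) w = 0 := by
    intro v w hv hw m
    rw [add_comm, ← mulPow_mulPow]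
    exact inner_mulPow_one_of_mem_wandering hw (mulPow_mem hs m hv.2)
  rcases lt_or_gt_of_ne hk with h | h
  · rw [inner_mulPow_right]
    have := key hv hw (-k - 1).toNat
    rwa [Int.toNat_of_nonneg (by omega), sub_add_cancel] at this
  · rw [← inner_conj_symm]
    have := key hw hv (k - 1).toNat
    rw [Int.toNat_of_nonneg (by omega), sub_add_cancel] at this
    rw [this, map_zero]

theorem smoothOnCircle_fourier (k : ℤ) : SmoothOnCircle fun t => (fourier k t : ℂ) := by
  unfold SmoothOnCircle
  simp only [fourier_coe_apply]
  have h : ContDiff ℝ ∞ fun x : ℝ => (x : ℂ) := Complex.ofRealCLM.contDiff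
  fun_prop

/-- Since `w ⊥ λW`, the vector `u = λ⁻¹ w` is orthogonal to `W`. So the minus part of `w` and the
plus part of `u` are smooth, and together they determine `w` up to a constant. -/
theorem isSmoothClass_of_mem_wandering (hW : IsGrass W) {w : H n} (hw : w ∈ wandering W) :
    IsSmoothClass w := by
  set u := mulPow (-1) w with hu
  have huW : u ∈ Wᗮ := by
    rw [Submodule.mem_orthogonal]
    intro f hf
    rw [hu, inner_mulPow_right, neg_neg]
    exact inner_mulPow_one_of_mem_wandering hw hf
  obtain ⟨g, hg, hgw⟩ := hW.smooth_minus w hw.2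
  obtain ⟨q, hq, hqu⟩ := hW.smooth_plus u huW
  set d := (Hplus n).starProjection w - mulPow 1 ((Hplus n).starProjection u) with hd
  -- The definition of `d` shows no negative frequencies, this second form no positive ones; hence
  -- `d` is constant.
  have hd' : d = mulPow 1 ((Hplus n)ᗮ.starProjection u) - (Hplus n)ᗮ.starProjection w := by
    have h1 := Submodule.starProjection_add_starProjection_orthogonal (K := Hplus n) w
    have h2 := congrArg (mulPow 1)
      (Submodule.starProjection_add_starProjection_orthogonal (K := Hplus n) u)
    rw [map_add, hu, mulPow_mulPow, add_neg_cancel, mulPow_zero, ← hu] at h2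
    rw [hd, sub_eq_sub_iff_add_eq_add, h1, ← h2, add_comm]
  have hdc : d = ∑ j, inner ℂ (monomial 0 j) d • monomial 0 j := by
    rw [← sub_eq_zero]
    refine eq_zero_of_inner_monomial fun i l => ?_
    rw [inner_sub_right, inner_sum]
    simp only [inner_smul_right]
    have horth : ∀ j, inner ℂ (monomial i l : H n) (monomial 0 j)
        = if i = 0 ∧ l = j then 1 else 0 := fun j => by
      simpa using (orthonormal_iff_ite.1 (orthonormal_monomial (n := n))) (i, l) (0, j)
    simp only [horth]
    rcases lt_trichotomy i 0 with hi | rfl | hi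
    · have h1 : inner ℂ (monomial i l) d = 0 := by
        rw [hd, inner_sub_right, inner_mulPow_right, mulPow_monomial,
          mem_Hplus_iff.1 (Submodule.starProjection_apply_mem _ _) _ hi,
          mem_Hplus_iff.1 (Submodule.starProjection_apply_mem _ _) _ (by omega), sub_zero]
      simp [h1, hi.ne]
    · simp
    · have h1 : inner ℂ (monomial i l) d = 0 := by
        rw [hd', inner_sub_right, inner_mulPow_right, mulPow_monomial,
          mem_orthogonal_Hplus_iff.1 (Submodule.starProjection_apply_mem _ _) _ hi.le,
          mem_orthogonal_Hplus_iff.1 (Submodule.starProjection_apply_mem _ _) _ (by omega),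
          sub_zero]
      simp [h1, hi.ne']
  have hw' : w = (Hplus n)ᗮ.starProjection w + mulPow 1 ((Hplus n).starProjection u)
      + ∑ j, inner ℂ (monomial 0 j) d • monomial 0 j := by
    rw [← hdc, hd]
    have h1 := Submodule.starProjection_add_starProjection_orthogonal (K := Hplus n) w
    conv_lhs => rw [← h1]
    abel
  refine ⟨fun t => g t + (fourier 1 t : ℂ) • q t
    + ∑ j, inner ℂ (monomial 0 j) d • EuclideanSpace.single j (1 : ℂ), ?_, ?_⟩
  · exact (ContDiff.add hg (ContDiff.smul (smoothOnCircle_fourier 1) hq)).add contDiff_const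
  · have hsum : ∀ᵐ t ∂μ, (∑ j, inner ℂ (monomial 0 j) d • monomial 0 j : H n) t
        = ∑ j, inner ℂ (monomial 0 j) d • (EuclideanSpace.single j (1 : ℂ) : V n) := by
      filter_upwards [Lp.coeFn_finsetSum Finset.univ
          fun j => inner ℂ (monomial 0 j) d • (monomial 0 j : H n),
        ae_all_iff.2 fun j => Lp.coeFn_smul (inner ℂ (monomial 0 j) d) (monomial 0 j : H n),
        ae_all_iff.2 fun j => coeFn_monomial (n := n) 0 j] with t h1 h2 h3
      rw [h1]
      simp [h2, h3]
    filter_upwards [hgw, hqu, hsum, coeFn_mulPow 1 ((Hplus n).starProjection u),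
      Lp.coeFn_add ((Hplus n)ᗮ.starProjection w + mulPow 1 ((Hplus n).starProjection u))
        (∑ j, inner ℂ (monomial 0 j) d • monomial 0 j),
      Lp.coeFn_add ((Hplus n)ᗮ.starProjection w) (mulPow 1 ((Hplus n).starProjection u))]
      with t h1 h2 h3 h4 h5 h6
    conv_lhs => rw [hw']
    rw [h5, Pi.add_apply, h6, Pi.add_apply, h1, h4, h2, h3]

/-- The smooth representative of an element of the wandering subspace. -/
def smoothRep (hW : IsGrass W) (w : wandering W) : S1 → V n :=
  (isSmoothClass_of_mem_wandering hW w.2).choose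

theorem smoothOnCircle_smoothRep (hW : IsGrass W) (w : wandering W) :
    SmoothOnCircle (smoothRep hW w) :=
  (isSmoothClass_of_mem_wandering hW w.2).choose_spec.1

theorem ae_eq_smoothRep (hW : IsGrass W) (w : wandering W) : (w : H n) =ᵐ[μ] smoothRep hW w :=
  (isSmoothClass_of_mem_wandering hW w.2).choose_spec.2

theorem continuous_smoothRep (hW : IsGrass W) (w : wandering W) : Continuous (smoothRep hW w) :=
  (smoothOnCircle_smoothRep hW w).continuous

/-- Elements of the wandering subspace have pointwise constant inner products. -/
theorem inner_smoothRep (hW : IsGrass W) (hs : shift W ⊆ W) (v w : wandering W) (t : S1) :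
    inner ℂ (smoothRep hW v t) (smoothRep hW w t) = inner ℂ v w := by
  set F : S1 → ℂ := fun t => inner ℂ (smoothRep hW v t) (smoothRep hW w t) with hF
  have hFc : Continuous F := (continuous_smoothRep hW v).inner (continuous_smoothRep hW w)
  -- For `k ≠ 0` these vanish by `inner_wandering_mulPow`; continuity then makes `F` constant
  -- everywhere.
  have hcoeff : ∀ k, fourierCoeff F k = inner ℂ (v : H n) (mulPow (-k) w) := by
    intro k
    rw [fourierCoeff, L2.inner_def]
    apply integral_congr_ae
    filter_upwards [ae_eq_smoothRep hW v, ae_eq_smoothRep hW w, coeFn_mulPow (-k) (w : H n)]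
      with t h1 h2 h3
    rw [h3, h1, h2, inner_smul_right, smul_eq_mul]
  have h1 := ae_eq_const_of_fourierCoeff_eq_zero (F := F)
    ((memLp_top_of_bound hFc.aestronglyMeasurable _ (ae_of_all _ fun t =>
      (ContinuousMap.norm_coe_le_norm ⟨F, hFc⟩ t))).mono_exponent le_top)
    fun k hk => by rw [hcoeff, inner_wandering_mulPow hs v.2 w.2 (neg_ne_zero.2 hk)]
  have h2 := congrFun ((hFc.ae_eq_iff_eq μ continuous_const).1 h1) t
  rw [hcoeff, neg_zero, mulPow_zero] at h2
  exact h2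

/-- Evaluation of the smooth representative at a point of the circle. -/
def evalAt (hW : IsGrass W) (t : S1) : wandering W →ₗ[ℂ] V n where
  toFun w := smoothRep hW w t
  map_add' v w := by
    refine congrFun (((continuous_smoothRep hW (v + w)).ae_eq_iff_eq μ
      ((continuous_smoothRep hW v).add (continuous_smoothRep hW w))).1 ?_) t
    filter_upwards [ae_eq_smoothRep hW v, ae_eq_smoothRep hW w, ae_eq_smoothRep hW (v + w),
      Lp.coeFn_add (v : H n) (w : H n)] with t h1 h2 h3 h4
    rw [← h3, Submodule.coe_add, h4, Pi.add_apply, h1, h2, Pi.add_apply]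
  map_smul' c w := by
    refine congrFun (((continuous_smoothRep hW (c • w)).ae_eq_iff_eq μ
      ((continuous_smoothRep hW w).const_smul c)).1 ?_) t
    filter_upwards [ae_eq_smoothRep hW w, ae_eq_smoothRep hW (c • w),
      Lp.coeFn_smul c (w : H n)] with t h1 h3 h4
    rw [← h3, Submodule.coe_smul, h4, Pi.smul_apply, h1, Pi.smul_apply]

theorem evalAt_apply (hW : IsGrass W) (t : S1) (w : wandering W) :
    evalAt hW t w = smoothRep hW w t := rfl

/-- Constancy of the pointwise inner products makes evaluation norm preserving; in particular the
wandering subspace has dimension at most `n`. -/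
theorem evalAt_injective (hW : IsGrass W) (hs : shift W ⊆ W) (t : S1) :
    Function.Injective (evalAt hW t) := by
  rw [← LinearMap.ker_eq_bot, LinearMap.ker_eq_bot']
  intro w hw
  rw [← inner_self_eq_zero (𝕜 := ℂ), ← inner_smoothRep hW hs w w t, ← evalAt_apply, hw,
    inner_zero_left]

/-- The Wold decomposition: `W` is generated by its wandering subspace. -/
theorem eq_closure_span_mulPow_wandering (hW : IsGrass W) (hs : shift W ⊆ W) :
    W = (Submodule.span ℂ
      {f | ∃ (k : ℕ) (w : H n), w ∈ wandering W ∧ f = mulPow (k : ℤ) w}).topologicalClosure := by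
  have : CompleteSpace W := hW.isClosed.completeSpace_coe
  set U := (Submodule.span ℂ
    {f : H n | ∃ (k : ℕ) (w : H n), w ∈ wandering W ∧ f = mulPow (k : ℤ) w}).topologicalClosure
    with hU
  have : CompleteSpace U := (Submodule.isClosed_topologicalClosure _).completeSpace_coe
  have hUW : U ≤ W := Submodule.topologicalClosure_minimal _ (Submodule.span_le.2 (by
    rintro _ ⟨k, w, hw, rfl⟩
    exact mulPow_mem hs k hw.2)) hW.isClosed
  have : CompleteSpace (W.map (mulPow (n := n) 1).toLinearMap) :=
    LinearIsometry.completeSpace_map (mulPow 1) W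
  have hM := Submodule.sup_orthogonal_inf_of_hasOrthogonalProjection
    (K₁ := W.map (mulPow 1).toLinearMap) (K₂ := W) (by
      rintro _ ⟨f, hf, rfl⟩
      exact mulPow_mem hs 1 hf)
  -- Inductively `λ^(-m) f = λ a' + b` with `a' ∈ W` and `b` wandering. As `f ⊥ λ^m b`, `b = 0`, so
  -- `λ^(-m-1) f = a'` is in `W`, and `eq_zero_of_mulPow_neg_mem` applies.
  have hbot : Uᗮ ⊓ W = ⊥ := by
    rw [Submodule.eq_bot_iff]
    rintro f ⟨hfU, hfW⟩
    refine eq_zero_of_mulPow_neg_mem hW fun m => ?_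
    induction m with
    | zero => simpa [mulPow_zero] using hfW
    | succ m ih =>
      rw [← hM] at ih
      obtain ⟨a, ⟨a', ha', rfl⟩, b, hb, hab⟩ := Submodule.mem_sup.1 ih
      have h1 : inner ℂ b (mulPow (-(m : ℤ)) f) = 0 := by
        rw [inner_mulPow_right, neg_neg]
        exact (Submodule.mem_orthogonal _ _).1 hfU _
          (Submodule.le_topologicalClosure _ (Submodule.subset_span ⟨m, b, hb, rfl⟩))
      have h2 : inner ℂ b (mulPow 1 a') = 0 := by
        rw [← inner_conj_symm, inner_mulPow_one_of_mem_wandering hb ha', map_zero]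
      have h3 : b = 0 := by
        rw [← hab, inner_add_right] at h1
        change inner ℂ b (mulPow 1 a') + _ = 0 at h1
        rwa [h2, zero_add, inner_self_eq_zero] at h1
      rw [h3, add_zero] at hab
      have h4 := congrArg (mulPow (-1)) hab
      change mulPow (-1) (mulPow 1 a') = _ at h4
      rw [mulPow_mulPow, mulPow_mulPow, neg_add_cancel, mulPow_zero] at h4
      have h5 : (-((m + 1 : ℕ) : ℤ)) = -1 + -(m : ℤ) := by push_cast; ring
      rw [h5, ← h4]
      exact ha'
  have h := Submodule.sup_orthogonal_inf_of_hasOrthogonalProjection hUW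
  rw [hbot, sup_bot_eq] at h
  exact h.symm

/-- Every element of `W` lies pointwise in the span of the wandering subspace. -/
theorem ae_mem_range_evalAt (hW : IsGrass W) (hs : shift W ⊆ W) {f : H n} (hf : f ∈ W) :
    ∀ᵐ t ∂μ, f t ∈ LinearMap.range (evalAt hW t) := by
  let U : Submodule ℂ (H n) :=
    { carrier := {f | ∀ᵐ t ∂μ, f t ∈ LinearMap.range (evalAt hW t)}
      add_mem' := by
        intro f g hf hg
        filter_upwards [hf, hg, Lp.coeFn_add f g] with t h1 h2 h3
        rw [h3]
        exact add_mem h1 h2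
      zero_mem' := by
        filter_upwards [Lp.coeFn_zero (V n) 2 μ] with t h1
        rw [h1]
        exact zero_mem _
      smul_mem' := by
        intro c f hf
        filter_upwards [hf, Lp.coeFn_smul c f] with t h1 h2
        rw [h2]
        exact Submodule.smul_mem _ c h1 }
  -- An `L²` limit is an almost everywhere limit along a subsequence, and the ranges are finite
  -- dimensional, hence closed.
  have hU : IsClosed (U : Set (H n)) := by
    rw [← closure_subset_iff_isClosed]
    intro f hf
    obtain ⟨x, hx, hxf⟩ := mem_closure_iff_seq_limit.1 hf
    obtain ⟨φ, -, hφ⟩ := exists_subseq_tendsto_ae hxf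
    have hx' : ∀ᵐ t ∂μ, ∀ N, x N t ∈ LinearMap.range (evalAt hW t) := ae_all_iff.2 hx
    change ∀ᵐ t ∂μ, _
    filter_upwards [hφ, hx'] with t h1 h2
    exact (Submodule.closed_of_finiteDimensional _).mem_of_tendsto h1
      (Eventually.of_forall fun N => h2 _)
  have h : W ≤ U := by
    rw [eq_closure_span_mulPow_wandering hW hs]
    refine Submodule.topologicalClosure_minimal _ (Submodule.span_le.2 ?_) hU
    rintro _ ⟨k, w, hw, rfl⟩
    change ∀ᵐ t ∂μ, _
    filter_upwards [coeFn_mulPow (k : ℤ) w, ae_eq_smoothRep hW ⟨w, hw⟩] with t h1 h2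
    rw [h1]
    change w t = _ at h2
    rw [h2]
    exact Submodule.smul_mem _ _ ⟨⟨w, hw⟩, rfl⟩
  exact h hf

/-- If the top wedge power of `W` is that of `Hⁿ₊`, the wandering subspace has dimension `n`. -/
theorem evalAt_surjective (hW : IsGrass W) (hs : shift W ⊆ W)
    (hwedge : wedgePower n W = wedgePower n (Hplus n)) :
    Function.Surjective (evalAt hW 0) := by
  by_contra hsurj
  have : FiniteDimensional ℂ (wandering W) :=
    FiniteDimensional.of_injective _ (evalAt_injective hW hs 0)
  have hnt : ∀ t, LinearMap.range (evalAt hW t) ≠ ⊤ := by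
    intro t ht
    have h1 := LinearMap.finrank_range_of_inj (evalAt_injective hW hs t)
    rw [ht, ← LinearMap.finrank_range_of_inj (evalAt_injective hW hs 0), finrank_top] at h1
    exact hsurj (LinearMap.range_eq_top.1 (Submodule.eq_top_of_finrank_eq h1.symm))
  have hdet : ∀ f : Fin n → H n, (∀ i, f i ∈ W) →
      ∀ᵐ t ∂μ, (stdBasis n).det (fun i => f i t) = 0 := by
    intro f hf
    filter_upwards [ae_all_iff.2 fun i => ae_mem_range_evalAt hW hs (hf i)] with t ht
    by_contra h
    have h1 := ((stdBasis n).is_basis_iff_det.2 (isUnit_iff_ne_zero.2 h)).2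
    refine hnt t (eq_top_iff.2 ?_)
    rw [← h1, Submodule.span_le]
    rintro _ ⟨i, rfl⟩
    exact ht i
  have hmem : wedge (fun j : Fin n => (monomial 0 j : H n)) ∈ wedgePower n W := by
    rw [hwedge]
    exact Submodule.subset_span ⟨_, fun j => monomial_mem_Hplus le_rfl j, rfl⟩
  -- All determinants from `W` vanish, so any weight is admissible. The weight `λ⁻¹` on the constant
  -- wedge would make `λ⁻¹` Smirnov, despite its coefficient at `-1`.
  have h1 := isSmirnov_of_mem_wedgePower (fun t => (fourier (-1) t : ℂ)) (fun f hf =>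
    (isSmirnov_const 0).congr (by
      filter_upwards [hdet f hf] with t ht
      rw [ht, mul_zero])) hmem
  have h2 : IsSmirnov fun t => (fourier (-1) t : ℂ) := h1.congr (by
    filter_upwards [det_monomial_zero] with t ht
    rw [detFunctional_ιMulti, ht, mul_one])
  have h3 := (h2.isBddHardy (C := 1)
    (ae_of_all _ fun t => (norm_fourier_apply _ t).le)).coeff (-1) (by norm_num)
  rw [fourierCoeff_fourier] at h3
  simp at h3

/-! ### The loop built from the wandering subspace -/

/-- The matrix valued function whose columns are the smooth representatives of elements of the
wandering subspace. -/
def columnLoop (hW : IsGrass W) (w : Fin n → wandering W) (t : S1) : Matrix (Fin n) (Fin n) ℂ :=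
  Matrix.of fun i j => smoothRep hW (w j) t i

theorem smoothOnCircle_columnLoop (hW : IsGrass W) (w : Fin n → wandering W) (i j : Fin n) :
    SmoothOnCircle fun t => columnLoop hW w t i j :=
  ((EuclideanSpace.proj i : V n →L[ℂ] ℂ).restrictScalars ℝ).contDiff.comp
    (smoothOnCircle_smoothRep hW (w j))

theorem continuous_columnLoop (hW : IsGrass W) (w : Fin n → wandering W) :
    Continuous (columnLoop hW w) :=
  continuous_matrix fun i j => (smoothOnCircle_columnLoop hW w i j).continuous

variable {w : Fin n → wandering W}

theorem columnLoop_zero (hW : IsGrass W)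
    (hw : ∀ j, evalAt hW 0 (w j) = EuclideanSpace.single j (1 : ℂ)) : columnLoop hW w 0 = 1 := by
  ext i j
  change evalAt hW 0 (w j) i = _
  rw [hw, Matrix.one_apply]
  simp

/-- The Gram matrix of the columns does not depend on the point, and it is the identity at `t = 0`.
-/
theorem columnLoop_mem_unitaryGroup (hW : IsGrass W) (hs : shift W ⊆ W)
    (hw : ∀ j, evalAt hW 0 (w j) = EuclideanSpace.single j (1 : ℂ)) (t : S1) :
    columnLoop hW w t ∈ Matrix.unitaryGroup (Fin n) ℂ := by
  have key : ∀ s, star (columnLoop hW w s) * columnLoop hW w s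
      = Matrix.of fun i j => inner ℂ (w i) (w j) := by
    intro s
    ext i j
    rw [Matrix.of_apply, ← inner_smoothRep hW hs (w i) (w j) s, PiLp.inner_apply,
      Matrix.mul_apply]
    refine Finset.sum_congr rfl fun k _ => ?_
    simp [columnLoop, Matrix.star_apply, mul_comm]
  rw [Matrix.mem_unitaryGroup_iff', key, ← key 0, columnLoop_zero hW hw, star_one, one_mul]

theorem loopIso_columnLoop_monomial (hW : IsGrass W) (hc : Continuous (columnLoop hW w))
    (hu : ∀ t, columnLoop hW w t ∈ Matrix.unitaryGroup (Fin n) ℂ) (k : ℤ) (j : Fin n) :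
    loopIso (columnLoop hW w) hc hu (monomial k j) = mulPow k (w j) := by
  have hcol : ∀ t, Matrix.toEuclideanLin (columnLoop hW w t) (EuclideanSpace.single j (1 : ℂ))
      = smoothRep hW (w j) t := by
    intro t
    ext i
    simp [Matrix.toLpLin_apply, columnLoop]
  ext1
  filter_upwards [coeFn_loopIso (columnLoop hW w) hc hu (monomial k j),
    coeFn_monomial k j, coeFn_mulPow k (w j : H n), ae_eq_smoothRep hW (w j)] with t h1 h2 h3 h4
  rw [h1, h2, h3, h4, map_smul, hcol]

theorem mulPow_eq_sum_of_mem_wandering (hW : IsGrass W) (hs : shift W ⊆ W)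
    (hw : ∀ j, evalAt hW 0 (w j) = EuclideanSpace.single j (1 : ℂ)) (k : ℤ) (v : wandering W) :
    mulPow k (v : H n) = ∑ j, evalAt hW 0 v j • mulPow k (w j : H n) := by
  have h : v = ∑ j, evalAt hW 0 v j • w j := by
    refine evalAt_injective hW hs 0 ?_
    simp only [map_sum, map_smul, hw]
    ext i
    simp [Pi.single_apply]
  calc mulPow k (v : H n) = mulPow k ((wandering W).subtype (∑ j, evalAt hW 0 v j • w j)) := by
        rw [← h, Submodule.subtype_apply]
    _ = ∑ j, evalAt hW 0 v j • mulPow k (w j : H n) := by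
        simp only [map_sum, map_smul, Submodule.subtype_apply]

theorem Hplus_le_comap (hW : IsGrass W) (hs : shift W ⊆ W) (Γ : H n →ₗᵢ[ℂ] H n)
    (hΓ : ∀ (k : ℤ) j, Γ (monomial k j) = mulPow k (w j : H n)) :
    Hplus n ≤ W.comap Γ.toLinearMap := by
  refine Hplus_le (hW.isClosed.preimage Γ.continuous) fun k j => ?_
  rw [Submodule.mem_comap, LinearIsometry.coe_toLinearMap, hΓ]
  exact mulPow_mem hs k (w j).2.2

/-- An isometry has closed image on `Hplus n`, so by the Wold decomposition only the vectors `λ^k v`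
with `v` wandering matter, and these are combinations of the `λ^k w_j`. -/
theorem le_map_Hplus (hW : IsGrass W) (hs : shift W ⊆ W)
    (hw : ∀ j, evalAt hW 0 (w j) = EuclideanSpace.single j (1 : ℂ)) (Γ : H n →ₗᵢ[ℂ] H n)
    (hΓ : ∀ (k : ℤ) j, Γ (monomial k j) = mulPow k (w j : H n)) :
    W ≤ (Hplus n).map Γ.toLinearMap := by
  have hclosed : IsClosed ((Hplus n).map Γ.toLinearMap : Set (H n)) :=
    Γ.isometry.isClosedEmbedding.isClosedMap _ (Submodule.isClosed_topologicalClosure _)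
  conv_lhs => rw [eq_closure_span_mulPow_wandering hW hs]
  refine Submodule.topologicalClosure_minimal _ (Submodule.span_le.2 ?_) hclosed
  rintro _ ⟨k, v, hv, rfl⟩
  have h1 := mulPow_eq_sum_of_mem_wandering hW hs hw k ⟨v, hv⟩
  rw [SetLike.mem_coe, h1]
  refine Submodule.sum_mem _ fun j _ => Submodule.smul_mem _ _ ?_
  rw [← hΓ]
  exact Submodule.mem_map_of_mem (monomial_mem_Hplus (Int.natCast_nonneg k) j)

theorem coe_eq_loopImage_columnLoop (hW : IsGrass W) (hs : shift W ⊆ W)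
    (hw : ∀ j, evalAt hW 0 (w j) = EuclideanSpace.single j (1 : ℂ)) :
    (W : Set (H n)) = loopImage (columnLoop hW w) (Hplus n) := by
  have hc := continuous_columnLoop hW w
  have hu := columnLoop_mem_unitaryGroup hW hs hw
  have hΓ := loopIso_columnLoop_monomial hW hc hu
  ext g
  rw [mem_loopImage_iff _ hc hu]
  constructor
  · intro hg
    obtain ⟨f, hf, hfg⟩ := le_map_Hplus hW hs hw _ hΓ hg
    exact ⟨f, hf, hfg⟩
  · rintro ⟨f, hf, rfl⟩
    exact Hplus_le_comap hW hs _ hΓ hf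

end LoopGrassmannian

end

/-! ### The equivalence -/

open LoopGrassmannian in
theorem mainTheorem5 (n : ℕ) (W : Submodule ℂ (LoopGrassmannian.H n))
    (hW : W ∈ LoopGrassmannian.Gr n) :
    (∃ γ : LoopGrassmannian.BasedLoop (Matrix.specialUnitaryGroup (Fin n) ℂ),
      LoopGrassmannian.CorrespondsTo W γ) ↔
    W ∈ LoopGrassmannian.GrSU n := by
  constructor
  · rintro ⟨γ, hγ⟩
    have hc : Continuous γ.toFun :=
      continuous_matrix fun i j => (γ.smooth i j).continuous
    refine ⟨hW, wedgePower_eq_of_eq_loopImage hc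
      (fun t => (Matrix.mem_specialUnitaryGroup_iff.1 (γ.mem t)).1)
      (fun t => (Matrix.mem_specialUnitaryGroup_iff.1 (γ.mem t)).2) hγ⟩
  · rintro ⟨⟨hG, hs⟩, hwedge⟩
    -- Prescribing the values `e_j` at `t = 0` gives both orthonormal columns and the base point
    -- condition.
    choose w hw using fun j : Fin n =>
      evalAt_surjective hG hs hwedge (EuclideanSpace.single j (1 : ℂ))
    have hu := columnLoop_mem_unitaryGroup hG hs hw
    have hWγ := coe_eq_loopImage_columnLoop hG hs hw
    have hdet := det_eq_of_wedgePower_eq (continuous_columnLoop hG w) hu hWγ hwedge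
    rw [columnLoop_zero hG hw, Matrix.det_one] at hdet
    exact ⟨⟨columnLoop hG w, fun t => Matrix.mem_specialUnitaryGroup_iff.2 ⟨hu t, hdet t⟩,
      smoothOnCircle_columnLoop hG w, columnLoop_zero hG hw⟩, hWγ⟩
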